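/- Let $k$ be a perfect field, let $n\ge 0$, let $R=k[x_0,\dots,x_n]$ with its standard grading, and let $I\subseteq R$ be a homogeneous radical ideal of dimension $d\ge 0$, where the dimension of $I$ is that of the projective variety it defines, i.e. $\dim I=\dim_{\mathrm{Krull}}(R/I)-1$. Assume that $I$ is unmixed, i.e. that all its associated prime ideals have the same dimension. Let $h_I(m)=\dim_k (R/I)_m$ be the Hilbert function of $I$, let $p_I=a_d t^d+\dots+a_0\in\mathbb{Q}[t]$ be its Hilbert polynomial (the polynomial with $h_I(m)=p_I(m)$ for all large $m$), and let $\deg I=d!\,a_d\in\mathbb{N}$ be the degree of $I$. Then $$h_I(m)\le \binom{m+\deg I+d}{d+1}-\binom{m+d}{d+1}\qquad\text{for all integers } m\ge 1.$$ -/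

import Mathlib

noncomputable section

namespace HomogeneousIdeals

open MvPolynomial

attribute [local instance] MvPolynomial.gradedAlgebra in
/-- `I` is a homogeneous ideal of `k[x₀, …, xₙ]` for the standard grading. -/
def IsHomogeneousIdeal {k : Type*} [Field k] {n : ℕ}
    (I : Ideal (MvPolynomial (Fin (n + 1)) k)) : Prop :=
  I.IsHomogeneous (homogeneousSubmodule (Fin (n + 1)) k)

/-- The Hilbert function `m ↦ dim_k (k[x₀, …, xₙ] / I)_m`. The homogeneous part of degree `m` of the
quotient is the image of the space of homogeneous polynomials of degree `m`. -/
def hilbertFunction {k : Type*} [Field k] {n : ℕ} (I : Ideal (MvPolynomial (Fin (n + 1)) k))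
    (m : ℕ) : ℕ :=
  Module.finrank k
    ((homogeneousSubmodule (Fin (n + 1)) k m).map (Ideal.Quotient.mkₐ k I).toLinearMap)

/-- `p` is a Hilbert polynomial of `I`: it agrees with the Hilbert function at all large `m`.
There is at most one such `p`. -/
def IsHilbertPolynomial {k : Type*} [Field k] {n : ℕ} (I : Ideal (MvPolynomial (Fin (n + 1)) k))
    (p : Polynomial ℚ) : Prop :=
  ∃ m₀ : ℕ, ∀ m : ℕ, m₀ ≤ m → (hilbertFunction I m : ℚ) = p.eval (m : ℚ)

open scoped Classical in
/-- The Hilbert polynomial of `I` (it exists for every homogeneous ideal; the value `0` is used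
where it does not exist). -/
def hilbertPolynomial {k : Type*} [Field k] {n : ℕ} (I : Ideal (MvPolynomial (Fin (n + 1)) k)) :
    Polynomial ℚ :=
  if h : ∃ p : Polynomial ℚ, IsHilbertPolynomial I p then h.choose else 0

/-- `I` has projective dimension `d`, that is, `k[x₀, …, xₙ] / I` has Krull dimension `d + 1`. -/
def HasDim {k : Type*} [Field k] {n : ℕ} (I : Ideal (MvPolynomial (Fin (n + 1)) k))
    (d : ℕ) : Prop :=
  ringKrullDim (MvPolynomial (Fin (n + 1)) k ⧸ I) = (d : WithBot ℕ∞) + 1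

/-- The degree `d! * a_d` of a homogeneous ideal `I` of projective dimension `d ≥ 0`, where `a_d` is
the coefficient of `t ^ d` in the Hilbert polynomial of `I`. This rational number is a positive
integer, so that the floor only turns it into a natural number. -/
def degree {k : Type*} [Field k] {n : ℕ} (I : Ideal (MvPolynomial (Fin (n + 1)) k)) (d : ℕ) : ℕ :=
  ⌊(d.factorial : ℚ) * (hilbertPolynomial I).coeff d⌋₊

/-- `I` is unmixed: all its associated primes (those of the module `k[x₀, …, xₙ] / I`) have the same
dimension. -/
def IsUnmixed {k : Type*} [Field k] {n : ℕ} (I : Ideal (MvPolynomial (Fin (n + 1)) k)) : Prop :=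
  ∀ P ∈ associatedPrimes (MvPolynomial (Fin (n + 1)) k) (MvPolynomial (Fin (n + 1)) k ⧸ I),
    ∀ Q ∈ associatedPrimes (MvPolynomial (Fin (n + 1)) k) (MvPolynomial (Fin (n + 1)) k ⧸ I),
      ringKrullDim (MvPolynomial (Fin (n + 1)) k ⧸ P) =
        ringKrullDim (MvPolynomial (Fin (n + 1)) k ⧸ Q)

end HomogeneousIdeals

end

/-!
Let `P` be a homogeneous prime of dimension `d`, over an infinite perfect field `k`. Noether
normalization makes `k[x] / P` integral over a polynomial ring `k[l] = k[l₀, …, l_d]` in linear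
forms, separably so because `k` is perfect, and some linear form `u` generates the extension of
fraction fields, of degree `r` say. The traces of a form `y` of degree `m` against
`1, u, …, u^(r-1)` are forms in `l` of degrees `m, …, m + r - 1`. Nondegeneracy of the trace form
therefore embeds `(k[x] / P)_m` into `⨁_{i < r} k[l]_{m + i}`, which gives
`h_P(m) ≤ ∑_{i < r} C(m + i + d, d)`. Conversely the products of the powers `1, u, …, u^(r-1)` with
the forms of suitable degrees in `l` are independent, so that `r * C(m + d, d) ≤ h_P(m + r)`.

Since `h_I ≤ ∑ h_P` over the minimal primes `P` of a radical ideal `I`, and since the binomials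
increase in `i`, the bound for `I` follows from `∑ r_P ≤ deg I`, which is the second estimate summed
over `P`. Arbitrary perfect fields are reduced to infinite ones by passing to the algebraic closure:
the extension is separable, so the extended ideal is still radical.
-/

namespace HomogeneousIdeals

open MvPolynomial

section LinearAlgebra

theorem finrank_range_eq_of_ker_eq {R V W W' : Type*} [Ring R] [AddCommGroup V] [Module R V]
    [AddCommGroup W] [Module R W] [AddCommGroup W'] [Module R W'] (f : V →ₗ[R] W) (g : V →ₗ[R] W')
    (h : LinearMap.ker f = LinearMap.ker g) :
    Module.finrank R (LinearMap.range f) = Module.finrank R (LinearMap.range g) :=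
  (f.quotKerEquivRange.symm ≪≫ₗ Submodule.quotEquivOfEq _ _ h ≪≫ₗ g.quotKerEquivRange).finrank_eq

variable {k U V W W' : Type*} [Field k] [AddCommGroup U] [Module k U] [AddCommGroup V] [Module k V]
  [AddCommGroup W] [Module k W] [AddCommGroup W'] [Module k W'] [FiniteDimensional k V]

theorem finrank_range_le_of_ker_le (f : V →ₗ[k] W) (g : V →ₗ[k] W')
    (h : LinearMap.ker f ≤ LinearMap.ker g) :
    Module.finrank k (LinearMap.range g) ≤ Module.finrank k (LinearMap.range f) := by
  have hf := LinearMap.finrank_range_add_finrank_ker f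
  have hg := LinearMap.finrank_range_add_finrank_ker g
  have hker := Submodule.finrank_mono h
  lia

theorem finrank_range_eq_add_of_ker_eq_sup (f : V →ₗ[k] W) (g : V →ₗ[k] W') (u : U →ₗ[k] V)
    (h : LinearMap.ker g = LinearMap.ker f ⊔ LinearMap.range u) :
    Module.finrank k (LinearMap.range f) =
      Module.finrank k (LinearMap.range (f ∘ₗ u)) + Module.finrank k (LinearMap.range g) := by
  have hle : LinearMap.ker f ≤ LinearMap.ker g := h ▸ le_sup_left
  have hrange : LinearMap.range (f.domRestrict (LinearMap.ker g)) = LinearMap.range (f ∘ₗ u) := by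
    rw [LinearMap.range_domRestrict, h, Submodule.map_sup, LinearMap.le_ker_iff_map.mp le_rfl,
      bot_sup_eq, LinearMap.range_comp]
  have hker : Module.finrank k (LinearMap.ker (f.domRestrict (LinearMap.ker g))) =
      Module.finrank k (LinearMap.ker f) := by
    rw [LinearMap.ker_domRestrict]
    exact (Submodule.comapSubtypeEquivOfLe hle).finrank_eq
  have hf := LinearMap.finrank_range_add_finrank_ker f
  have hg := LinearMap.finrank_range_add_finrank_ker g
  have hfg := LinearMap.finrank_range_add_finrank_ker (f.domRestrict (LinearMap.ker g))
  rw [hrange, hker] at hfg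
  lia

variable {ι : Type*} [Fintype ι]

theorem finrank_range_le_sum_of_iInf_ker_le {X : ι → Type*} [∀ i, AddCommGroup (X i)]
    [∀ i, Module k (X i)] (f : V →ₗ[k] W) (g : ∀ i, V →ₗ[k] X i)
    (h : ⨅ i, LinearMap.ker (g i) ≤ LinearMap.ker f) :
    Module.finrank k (LinearMap.range f) ≤ ∑ i, Module.finrank k (LinearMap.range (g i)) := by
  let G := LinearMap.pi fun i ↦ (g i).rangeRestrict
  have hG : LinearMap.ker G ≤ LinearMap.ker f := by
    simpa only [G, LinearMap.ker_pi, LinearMap.ker_rangeRestrict] using h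
  rw [← Module.finrank_pi_fintype k]
  exact (finrank_range_le_of_ker_le G f hG).trans (Submodule.finrank_le _)

theorem sum_finrank_range_le_of_ker_le_ker_piMap {X Y : ι → Type*} [∀ i, AddCommGroup (X i)]
    [∀ i, Module k (X i)] [∀ i, FiniteDimensional k (X i)] [∀ i, AddCommGroup (Y i)]
    [∀ i, Module k (Y i)] (T : (∀ i, X i) →ₗ[k] W) (g : ∀ i, X i →ₗ[k] Y i)
    (h : LinearMap.ker T ≤ LinearMap.ker (LinearMap.piMap g)) :
    ∑ i, Module.finrank k (LinearMap.range (g i)) ≤ Module.finrank k (LinearMap.range T) := by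
  let G := LinearMap.piMap fun i ↦ (g i).rangeRestrict
  have hG : LinearMap.range G = ⊤ := LinearMap.range_eq_top.mpr <|
    Function.Surjective.piMap fun i ↦ (g i).surjective_rangeRestrict
  have hker : LinearMap.ker T ≤ LinearMap.ker G := fun v hv ↦
    funext fun i ↦ Subtype.ext (congrFun (h hv) i)
  rw [← Module.finrank_pi_fintype k, ← finrank_top k (∀ i, LinearMap.range (g i)), ← hG]
  exact finrank_range_le_of_ker_le T G hker

end LinearAlgebra

section Homogeneous

variable {σ R : Type*}

instance finite_homogeneousSubmodule [CommSemiring R] [Finite σ] (m : ℕ) :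
    Module.Finite R (homogeneousSubmodule σ R m) :=
  Module.Finite.iff_fg.mpr (homogeneousSubmodule_fg σ R m)

theorem finrank_homogeneousSubmodule [CommRing R] [Nontrivial R] [Fintype σ] (m : ℕ) :
    Module.finrank R (homogeneousSubmodule σ R m) = (Fintype.card σ + m - 1).choose m := by
  classical
  have hset : {e : σ →₀ ℕ | e.degree = m} = (Finset.univ : Finset σ).finsuppAntidiag m := by
    ext e
    simp [Finsupp.degree_eq_sum]
  have hsub : homogeneousSubmodule σ R m =
      restrictSupport R ((Finset.univ : Finset σ).finsuppAntidiag m : Set (σ →₀ ℕ)) :=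
    hset ▸ homogeneousSubmodule_eq_finsupp_supported σ R m
  rw [hsub, Module.finrank_eq_card_basis (basisRestrictSupport R _)]
  simp only [SetLike.coe_sort_coe, Fintype.card_coe, Finset.card_finsuppAntidiag_nat_eq_choose,
    Finset.card_univ]

theorem finrank_homogeneousSubmodule_fin [CommRing R] [Nontrivial R] (d m : ℕ) :
    Module.finrank R (homogeneousSubmodule (Fin (d + 1)) R m) = (m + d).choose d := by
  rw [finrank_homogeneousSubmodule, Fintype.card_fin, show d + 1 + m - 1 = m + d by lia,
    Nat.choose_symm_add]

theorem homogeneousComponent_mul_of_isHomogeneous [CommSemiring R] {a : ℕ} {p : MvPolynomial σ R}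
    (hp : p.IsHomogeneous a) (m : ℕ) (f : MvPolynomial σ R) :
    homogeneousComponent (a + m) (p * f) = p * homogeneousComponent m f := by
  let _ := MvPolynomial.gradedAlgebra (σ := σ) (R := R)
  have key := DirectSum.coe_decompose_mul_add_of_left_mem (homogeneousSubmodule σ R) (i := a)
    (j := m) (b := f) hp
  have hdec (g : MvPolynomial σ R) (i : ℕ) :
      (DirectSum.decompose (homogeneousSubmodule σ R) g i : MvPolynomial σ R) =
        homogeneousComponent i g :=
    decomposition.decompose'_apply g i
  rwa [hdec, hdec] at key

theorem mem_of_isHomogeneous_of_forall_X_mem [CommSemiring R] {I : Ideal (MvPolynomial σ R)}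
    (hI : ∀ i, X i ∈ I) {m : ℕ} (hm : m ≠ 0) {f : MvPolynomial σ R} (hf : f.IsHomogeneous m) :
    f ∈ I := by
  have hspan : Ideal.span (X '' Set.univ) ≤ I :=
    Ideal.span_le.mpr (Set.image_subset_iff.mpr fun i _ ↦ hI i)
  refine hspan (mem_ideal_span_X_image.mpr fun e he ↦ ?_)
  have he0 : e ≠ 0 := by
    rintro rfl
    exact hm ((hf (mem_support_iff.mp he)).symm.trans (map_zero _))
  obtain ⟨i, hi⟩ := Finsupp.ne_iff.mp he0
  exact ⟨i, trivial, hi⟩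

end Homogeneous

section HilbertFunction

variable {k : Type*} [Field k] {n : ℕ} {I : Ideal (MvPolynomial (Fin (n + 1)) k)}

theorem isHomogeneousIdeal_iff :
    IsHomogeneousIdeal I ↔ ∀ f ∈ I, ∀ m, homogeneousComponent m f ∈ I :=
  ⟨fun h _ hf m ↦ homogeneousComponent_mem_of_mem h hf m,
    fun h m f hf ↦ (decomposition.decompose'_apply f m).symm ▸ h f hf m⟩

variable (I) in
/-- The linear map from the forms of degree `m` to the quotient by `I`, whose rank is the value of
the Hilbert function at `m`. -/
noncomputable def formsToQuotient (m : ℕ) :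
    homogeneousSubmodule (Fin (n + 1)) k m →ₗ[k] (MvPolynomial (Fin (n + 1)) k ⧸ I) :=
  (Ideal.Quotient.mkₐ k I).toLinearMap ∘ₗ (homogeneousSubmodule (Fin (n + 1)) k m).subtype

@[simp] theorem formsToQuotient_apply {m : ℕ} (f : homogeneousSubmodule (Fin (n + 1)) k m) :
    formsToQuotient I m f = Ideal.Quotient.mk I f := rfl

theorem mem_ker_formsToQuotient {m : ℕ} {f : homogeneousSubmodule (Fin (n + 1)) k m} :
    f ∈ LinearMap.ker (formsToQuotient I m) ↔ (f : MvPolynomial (Fin (n + 1)) k) ∈ I := by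
  rw [LinearMap.mem_ker, formsToQuotient_apply, Ideal.Quotient.eq_zero_iff_mem]

theorem hilbertFunction_eq_finrank_range (m : ℕ) :
    hilbertFunction I m = Module.finrank k (LinearMap.range (formsToQuotient I m)) := by
  rw [formsToQuotient, LinearMap.range_comp, Submodule.range_subtype]
  rfl

variable {a : ℕ} {p : MvPolynomial (Fin (n + 1)) k}

theorem IsHomogeneousIdeal.colon_singleton (hI : IsHomogeneousIdeal I) (hp : p.IsHomogeneous a) :
    IsHomogeneousIdeal (I.colon {p}) := by
  rw [isHomogeneousIdeal_iff] at hI ⊢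
  intro f hf m
  rw [Submodule.mem_colon_singleton, smul_eq_mul, mul_comm] at hf ⊢
  rw [← homogeneousComponent_mul_of_isHomogeneous hp]
  exact hI _ hf _

theorem IsHomogeneousIdeal.sup_span_singleton (hI : IsHomogeneousIdeal I)
    (hp : p.IsHomogeneous a) : IsHomogeneousIdeal (I ⊔ Ideal.span {p}) := by
  let _ := MvPolynomial.gradedAlgebra (σ := Fin (n + 1)) (R := k)
  refine Ideal.IsHomogeneous.sup hI (Ideal.homogeneous_span _ _ ?_)
  rintro _ rfl
  exact ⟨a, hp⟩

/-- Multiplication by a form of degree `a`, on the forms of degree `m`. -/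
noncomputable def mulForm (hp : p.IsHomogeneous a) (m : ℕ) :
    homogeneousSubmodule (Fin (n + 1)) k m →ₗ[k] homogeneousSubmodule (Fin (n + 1)) k (a + m) :=
  (LinearMap.mulLeft k p).restrict fun _ hf ↦ hp.mul hf

@[simp] theorem coe_mulForm_apply (hp : p.IsHomogeneous a) {m : ℕ}
    (f : homogeneousSubmodule (Fin (n + 1)) k m) :
    (mulForm hp m f : MvPolynomial (Fin (n + 1)) k) = p * f := rfl

theorem ker_formsToQuotient_sup_span_singleton (hI : IsHomogeneousIdeal I)
    (hp : p.IsHomogeneous a) (m : ℕ) :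
    LinearMap.ker (formsToQuotient (I ⊔ Ideal.span {p}) (a + m)) =
      LinearMap.ker (formsToQuotient I (a + m)) ⊔ LinearMap.range (mulForm hp m) := by
  apply le_antisymm
  · intro f hf
    obtain ⟨u, hu, v, hv, huv⟩ := Submodule.mem_sup.mp (mem_ker_formsToQuotient.mp hf)
    obtain ⟨g, rfl⟩ := Ideal.mem_span_singleton'.mp hv
    let gm : homogeneousSubmodule (Fin (n + 1)) k m :=
      ⟨homogeneousComponent m g, homogeneousComponent_mem m g⟩
    have hdecomp : homogeneousComponent (a + m) u + p * homogeneousComponent m g =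
        (f : MvPolynomial (Fin (n + 1)) k) := by
      rw [← homogeneousComponent_mul_of_isHomogeneous hp, mul_comm p, ← map_add, huv,
        homogeneousComponent_eq_self f.2]
    refine Submodule.mem_sup.mpr ⟨f - mulForm hp m gm, ?_, mulForm hp m gm, ⟨gm, rfl⟩,
      sub_add_cancel _ _⟩
    rw [mem_ker_formsToQuotient, Submodule.coe_sub, ← hdecomp]
    exact (add_sub_cancel_right (homogeneousComponent (a + m) u) _).symm ▸
      isHomogeneousIdeal_iff.mp hI u hu _
  · refine sup_le (fun f hf ↦ ?_) ?_
    · exact mem_ker_formsToQuotient.mpr (Ideal.mem_sup_left (mem_ker_formsToQuotient.mp hf))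
    · rintro _ ⟨f, rfl⟩
      exact mem_ker_formsToQuotient.mpr
        (Ideal.mul_mem_right _ _ (Ideal.mem_sup_right (Ideal.mem_span_singleton_self p)))

theorem hilbertFunction_colon_add_hilbertFunction_sup (hI : IsHomogeneousIdeal I)
    (hp : p.IsHomogeneous a) (m : ℕ) :
    hilbertFunction I (a + m) =
      hilbertFunction (I.colon {p}) m + hilbertFunction (I ⊔ Ideal.span {p}) (a + m) := by
  simp only [hilbertFunction_eq_finrank_range]
  rw [finrank_range_eq_add_of_ker_eq_sup _ _ _ (ker_formsToQuotient_sup_span_singleton hI hp m)]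
  congr 1
  refine finrank_range_eq_of_ker_eq _ _ (Submodule.ext fun f ↦ ?_)
  rw [LinearMap.ker_comp, Submodule.mem_comap, mem_ker_formsToQuotient, mem_ker_formsToQuotient,
    Submodule.mem_colon_singleton, coe_mulForm_apply, smul_eq_mul, mul_comm]

end HilbertFunction

section HilbertPolynomial

theorem exists_polynomial_forward_difference (q : Polynomial ℚ) :
    ∃ p : Polynomial ℚ, ∀ x : ℚ, p.eval (x + 1) = p.eval x + q.eval x := by
  induction q using Polynomial.induction_on' with
  | add p q hp hq =>
    obtain ⟨a, ha⟩ := hp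
    obtain ⟨b, hb⟩ := hq
    refine ⟨a + b, fun x ↦ ?_⟩
    simp only [Polynomial.eval_add, ha, hb]
    ring
  | monomial n a =>
    refine ⟨Polynomial.C (a / (n + 1)) * Polynomial.bernoulli (n + 1), fun x ↦ ?_⟩
    have hn : (n : ℚ) + 1 ≠ 0 := by positivity
    rw [Polynomial.eval_mul, Polynomial.eval_mul, add_comm x, Polynomial.bernoulli_eval_one_add,
      mul_add, Polynomial.eval_C, Polynomial.eval_monomial, Nat.cast_succ, Nat.add_sub_cancel,
      ← mul_assoc, div_mul_cancel₀ _ hn, Polynomial.eval_C]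

theorem exists_polynomial_of_forward_difference {h : ℕ → ℚ} {q : Polynomial ℚ} {m₀ : ℕ}
    (hq : ∀ m, m₀ ≤ m → h (m + 1) = h m + q.eval (m : ℚ)) :
    ∃ p : Polynomial ℚ, ∀ m, m₀ ≤ m → h m = p.eval (m : ℚ) := by
  obtain ⟨p, hp⟩ := exists_polynomial_forward_difference q
  refine ⟨p + Polynomial.C (h m₀ - p.eval (m₀ : ℚ)), fun m hm ↦ ?_⟩
  induction m, hm using Nat.le_induction with
  | base => simp
  | succ m hm ih =>
    rw [hq m hm, ih]
    simp only [Polynomial.eval_add, Polynomial.eval_C, Nat.cast_succ, hp]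
    ring

variable {k : Type*} [Field k] {n : ℕ} {I : Ideal (MvPolynomial (Fin (n + 1)) k)}

theorem isHilbertPolynomial_zero_of_forall_X_mem (hI : ∀ i, X i ∈ I) :
    IsHilbertPolynomial I 0 := by
  refine ⟨1, fun m hm ↦ ?_⟩
  have hzero : formsToQuotient I m = 0 := LinearMap.ext fun f ↦
    Ideal.Quotient.eq_zero_iff_mem.mpr (mem_of_isHomogeneous_of_forall_X_mem hI (by lia) f.2)
  rw [hilbertFunction_eq_finrank_range, hzero, LinearMap.range_zero, finrank_bot,
    Polynomial.eval_zero, Nat.cast_zero]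

theorem exists_isHilbertPolynomial_of_colon_eq (hI : IsHomogeneousIdeal I) (i : Fin (n + 1))
    (hc : I.colon {X i} = I) (hJ : ∃ p, IsHilbertPolynomial (I ⊔ Ideal.span {X i}) p) :
    ∃ p, IsHilbertPolynomial I p := by
  obtain ⟨q, m₀, hq⟩ := hJ
  obtain ⟨p, hp⟩ := exists_polynomial_of_forward_difference (h := fun m ↦ hilbertFunction I m)
    (q := q.comp (Polynomial.X + 1)) (m₀ := m₀) fun m hm ↦ by
      rw [add_comm m, hilbertFunction_colon_add_hilbertFunction_sup hI (isHomogeneous_X k i), hc,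
        Nat.cast_add, hq _ (by lia)]
      simp [add_comm]
  exact ⟨p, m₀, hp⟩

theorem exists_isHilbertPolynomial_of_colon (hI : IsHomogeneousIdeal I) (i : Fin (n + 1))
    (hc : ∃ p, IsHilbertPolynomial (I.colon {X i}) p)
    (hJ : ∃ p, IsHilbertPolynomial (I ⊔ Ideal.span {X i}) p) :
    ∃ p, IsHilbertPolynomial I p := by
  obtain ⟨p, m₁, hp⟩ := hc
  obtain ⟨q, m₂, hq⟩ := hJ
  refine ⟨p.comp (Polynomial.X - 1) + q, max m₁ m₂ + 1, fun m hm ↦ ?_⟩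
  obtain ⟨m, rfl⟩ : ∃ l, m = 1 + l := ⟨m - 1, by lia⟩
  rw [hilbertFunction_colon_add_hilbertFunction_sup hI (isHomogeneous_X k i), Nat.cast_add,
    hp m (by lia), hq (1 + m) (by lia)]
  simp

theorem exists_isHilbertPolynomial (I : Ideal (MvPolynomial (Fin (n + 1)) k))
    (hI : IsHomogeneousIdeal I) : ∃ p, IsHilbertPolynomial I p := by
  induction I using WellFoundedGT.induction with
  | ind I ih =>
  by_cases hX : ∀ i, X i ∈ I
  · exact ⟨0, isHilbertPolynomial_zero_of_forall_X_mem hX⟩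
  obtain ⟨i, hi⟩ := not_forall.mp hX
  have hlt : I < I ⊔ Ideal.span {X i} :=
    left_lt_sup.mpr fun h ↦ hi (h (Ideal.mem_span_singleton_self _))
  have hJ := ih _ hlt (hI.sup_span_singleton (isHomogeneous_X k i))
  by_cases hc : I.colon {X i} = I
  · exact exists_isHilbertPolynomial_of_colon_eq hI i hc hJ
  · exact exists_isHilbertPolynomial_of_colon hI i
      (ih _ (Ideal.le_colon.lt_of_ne' hc) (hI.colon_singleton (isHomogeneous_X k i))) hJ

theorem isHilbertPolynomial_hilbertPolynomial (hI : IsHomogeneousIdeal I) :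
    IsHilbertPolynomial I (hilbertPolynomial I) := by
  have h := exists_isHilbertPolynomial I hI
  rw [hilbertPolynomial, dif_pos h]
  exact h.choose_spec

end HilbertPolynomial

section LineSubstitution

variable {R ι B : Type*} [CommSemiring R] [CommSemiring B] [Algebra R B] (b : ι → B) (a : ι → R)

/-- Substitution along the line through the point `b` with direction `a`, as a polynomial in the
parameter `T` of the line: `X j ↦ b j + a j T`. -/
noncomputable def lineSubst : MvPolynomial ι R →ₐ[R] Polynomial B :=
  aeval fun j ↦ Polynomial.C (b j) + Polynomial.C (algebraMap R B (a j)) * Polynomial.X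

theorem lineSubst_X (j : ι) : lineSubst b a (X j) =
    Polynomial.C (b j) + Polynomial.C (algebraMap R B (a j)) * Polynomial.X :=
  aeval_X _ _

theorem natDegree_lineSubst_X_le (j : ι) : (lineSubst b a (X j)).natDegree ≤ 1 := by
  rw [lineSubst_X]
  compute_degree

theorem natDegree_lineSubst_monomial_le (d : ι →₀ ℕ) :
    (lineSubst b a (monomial d 1)).natDegree ≤ d.degree := by
  induction d using Finsupp.induction_linear with
  | zero => simp
  | add d e hd he =>
    rw [← mul_one (1 : R), ← monomial_mul, map_mul, map_add]
    exact Polynomial.natDegree_mul_le_of_le hd he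
  | single j m =>
    rw [← X_pow_eq_monomial, map_pow, Finsupp.degree_single]
    simpa using Polynomial.natDegree_pow_le_of_le m (natDegree_lineSubst_X_le b a j)

theorem coeff_degree_lineSubst_monomial (d : ι →₀ ℕ) :
    (lineSubst b a (monomial d 1)).coeff d.degree = algebraMap R B (eval a (monomial d 1)) := by
  induction d using Finsupp.induction_linear with
  | zero => simp
  | add d e hd he =>
    rw [← mul_one (1 : R), ← monomial_mul, map_mul, map_mul, map_mul, map_add,
      Polynomial.coeff_mul_add_eq_of_natDegree_le (natDegree_lineSubst_monomial_le b a d)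
        (natDegree_lineSubst_monomial_le b a e), hd, he]
  | single j m =>
    have h := Polynomial.coeff_pow_of_natDegree_le (m := m) (natDegree_lineSubst_X_le b a j)
    rw [mul_one] at h
    rw [← X_pow_eq_monomial, map_pow, Finsupp.degree_single, h, lineSubst_X]
    simp

theorem lineSubst_eq_sum (f : MvPolynomial ι R) :
    lineSubst b a f = ∑ d ∈ f.support, coeff d f • lineSubst b a (monomial d 1) := by
  conv_lhs => rw [f.as_sum, map_sum]
  exact Finset.sum_congr rfl fun d _ ↦ by rw [← map_smul, smul_monomial, smul_eq_mul, mul_one]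

theorem natDegree_lineSubst_le (f : MvPolynomial ι R) :
    (lineSubst b a f).natDegree ≤ f.totalDegree := by
  rw [lineSubst_eq_sum]
  exact Polynomial.natDegree_sum_le_of_forall_le _ _ fun d hd ↦
    (Polynomial.natDegree_smul_le _ _).trans <|
      (natDegree_lineSubst_monomial_le b a d).trans (le_totalDegree hd)

theorem coeff_totalDegree_lineSubst (f : MvPolynomial ι R) :
    (lineSubst b a f).coeff f.totalDegree =
      algebraMap R B (eval a (homogeneousComponent f.totalDegree f)) := by
  rw [lineSubst_eq_sum, Polynomial.finsetSum_coeff, homogeneousComponent_apply,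
    Finset.sum_filter, map_sum, map_sum]
  refine Finset.sum_congr rfl fun d hd ↦ ?_
  rw [Polynomial.coeff_smul]
  split_ifs with h
  · rw [← h, coeff_degree_lineSubst_monomial, Algebra.smul_def, ← map_mul, ← smul_eval,
      smul_monomial, smul_eq_mul, mul_one]
  · have hlt : d.degree < f.totalDegree := (le_totalDegree hd).lt_of_ne h
    rw [Polynomial.coeff_eq_zero_of_natDegree_lt
      ((natDegree_lineSubst_monomial_le b a d).trans_lt hlt), smul_zero, map_zero, map_zero]

theorem derivative_lineSubst [Fintype ι] (f : MvPolynomial ι R) :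
    Polynomial.derivative (lineSubst b a f) =
      ∑ j, Polynomial.C (algebraMap R B (a j)) * lineSubst b a (pderiv j f) := by
  classical
  induction f using MvPolynomial.induction_on with
  | C c => simp [← algebraMap_eq, Polynomial.algebraMap_apply]
  | add p q hp hq => simp only [map_add, hp, hq, mul_add, Finset.sum_add_distrib]
  | mul_X p i hp =>
    have hX : Polynomial.derivative (lineSubst b a (X i)) =
        Polynomial.C (algebraMap R B (a i)) := by
      simp [lineSubst_X]
    have hpderiv (j : ι) : pderiv j (p * X i) = (if i = j then p else 0) + pderiv j p * X i := by
      rw [Derivation.leibniz, pderiv_X, smul_eq_mul, smul_eq_mul, mul_comm (X i), Pi.single_apply,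
        mul_ite, mul_one, mul_zero]
    simp only [hpderiv, map_mul, Polynomial.derivative_mul, hp, hX, map_add, mul_add, apply_ite,
      map_zero, mul_zero, Finset.sum_add_distrib, Finset.sum_mul, Finset.sum_ite_eq,
      Finset.mem_univ, if_true, mul_assoc]
    rw [add_comm, mul_comm (lineSubst b a p)]

theorem aeval_lineSubst {S : Type*} [CommSemiring S] [Algebra R S] [Algebra B S]
    [IsScalarTower R B S] (w : S) (f : MvPolynomial ι R) :
    Polynomial.aeval w (lineSubst b a f) = aeval (fun j ↦ algebraMap B S (b j) + a j • w) f := by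
  have h : ((Polynomial.aeval w).restrictScalars R).comp (lineSubst b a) =
      aeval fun j ↦ algebraMap B S (b j) + a j • w := by
    ext j
    simp [lineSubst_X, ← IsScalarTower.algebraMap_apply, Algebra.smul_def]
  exact DFunLike.congr_fun h f

end LineSubstitution

section MinimalRelation

theorem linearIndependent_pow_expChar {k L ι : Type*} [Field k] [CommRing L] [Algebra k L]
    [IsReduced L] (p : ℕ) [ExpChar k p] [ExpChar L p] [PerfectRing k p] {v : ι → L}
    (hv : LinearIndependent k v) : LinearIndependent k fun i ↦ v i ^ p := by
  refine hv.map_of_injective_injective (frobeniusEquiv k p).symm (frobenius L p).toAddMonoidHom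
    (by simp) (fun x hx ↦ frobenius_inj L p (hx.trans (map_zero _).symm)) fun c x ↦ ?_
  change ((frobeniusEquiv k p).symm c • x) ^ p = c • x ^ p
  rw [Algebra.smul_def, mul_pow, ← map_pow, frobeniusEquiv_symm_pow_p, Algebra.smul_def]

theorem totalDegree_pderiv_lt {R ι : Type*} [CommSemiring R] {f : MvPolynomial ι R} {i : ι}
    {s : ι →₀ ℕ} (hs : s ∈ f.support) (hi : s i ≠ 0) :
    (pderiv i f).totalDegree < f.totalDegree := by
  have hpos : 0 < f.totalDegree :=
    (Nat.pos_of_ne_zero hi).trans_le <| (Finsupp.le_degree i s).trans (le_totalDegree hs)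
  refine (Finset.sup_lt_iff hpos).mpr fun d hd ↦ ?_
  rw [mem_support_iff, coeff_pderiv] at hd
  have hle : (d + Finsupp.single i 1).degree ≤ f.totalDegree :=
    le_totalDegree (mem_support_iff.mpr (left_ne_zero_of_mul hd))
  rwa [map_add, Finsupp.degree_single, Nat.add_one_le_iff] at hle

theorem pderiv_ne_zero_of_natCast_ne_zero {R ι : Type*} [CommSemiring R] [NoZeroDivisors R]
    {f : MvPolynomial ι R} {i : ι} {s : ι →₀ ℕ} (hs : s ∈ f.support) (hi : (s i : R) ≠ 0) :
    pderiv i f ≠ 0 := by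
  have hpos : s i ≠ 0 := fun h ↦ hi (by rw [h, Nat.cast_zero])
  have hle : Finsupp.single i 1 ≤ s := by
    rw [Finsupp.single_le_iff]
    lia
  refine ne_zero_iff.mpr ⟨s - Finsupp.single i 1, ?_⟩
  rw [coeff_pderiv, tsub_add_cancel_of_le hle, Finsupp.tsub_apply, Finsupp.single_eq_same,
    ← Nat.cast_succ, Nat.succ_eq_add_one, Nat.sub_add_cancel (by lia)]
  exact mul_ne_zero (mem_support_iff.mp hs) hi

theorem homogeneousComponent_totalDegree_ne_zero {R ι : Type*} [CommSemiring R]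
    {f : MvPolynomial ι R} (hf : f ≠ 0) : homogeneousComponent f.totalDegree f ≠ 0 := by
  obtain ⟨s, hs, hsd⟩ :=
    Finset.exists_mem_eq_sup f.support (support_nonempty.mpr hf) Finsupp.degree
  refine ne_zero_iff.mpr ⟨s, ?_⟩
  have hdeg : s.degree = f.totalDegree := hsd.symm
  rw [coeff_homogeneousComponent, if_pos hdeg]
  exact mem_support_iff.mp hs

variable {k L ι : Type*} [Field k] [Field L] [Algebra k L] {l : ι → L}

theorem exists_relation_totalDegree_le (hl : ¬ AlgebraicIndependent k l) :
    ∃ f : MvPolynomial ι k, f ≠ 0 ∧ aeval l f = 0 ∧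
      ∀ g : MvPolynomial ι k, g ≠ 0 → aeval l g = 0 → f.totalDegree ≤ g.totalDegree := by
  rw [AlgebraicIndependent, injective_iff_map_eq_zero] at hl
  push Not at hl
  obtain ⟨f₀, hf₀, hf₀'⟩ := hl
  obtain ⟨f, ⟨hf, hf'⟩, hmin⟩ :=
    (InvImage.wf (totalDegree : MvPolynomial ι k → ℕ) wellFounded_lt).has_min
      {f | f ≠ 0 ∧ aeval l f = 0} ⟨f₀, hf₀', hf₀⟩
  exact ⟨f, hf, hf', fun g hg hg' ↦ not_lt.mp (hmin g ⟨hg, hg'⟩)⟩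

variable {f : MvPolynomial ι k}

theorem exists_mem_support_ne_zero_of_aeval_eq_zero (hf : f ≠ 0) (hfl : aeval l f = 0) :
    ∃ s ∈ f.support, ∃ i, s i ≠ 0 := by
  by_contra! h
  have hC : f = C (coeff 0 f) := by
    rw [← totalDegree_eq_zero_iff_eq_C, totalDegree_eq_zero_iff]
    exact h
  rw [hC, aeval_C, map_eq_zero] at hfl
  rw [hfl, map_zero] at hC
  exact hf hC

theorem exists_mem_support_natCast_ne_zero [PerfectField k]
    (hmin : ∀ g : MvPolynomial ι k, g ≠ 0 → aeval l g = 0 → f.totalDegree ≤ g.totalDegree)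
    (hf : f ≠ 0) (hfl : aeval l f = 0) : ∃ i, ∃ s ∈ f.support, (s i : k) ≠ 0 := by
  obtain _ | ⟨p, hp, _⟩ := CharP.exists' k
  · obtain ⟨s, hs, i, hi⟩ := exists_mem_support_ne_zero_of_aeval_eq_zero hf hfl
    exact ⟨i, s, hs, Nat.cast_ne_zero.mpr hi⟩
  have : ExpChar k p := .prime hp.out
  have : CharP L p := .of_ringHom_of_ne_zero (algebraMap k L) p hp.out.ne_zero
  obtain ⟨i, s, hs, h⟩ := exists_mem_support_not_dvd_of_forall_totalDegree_le p hp.out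
    (fun _ hs ↦ linearIndependent_pow_expChar p hs) hmin hf hfl
  exact ⟨i, s, hs, by rwa [Ne, CharP.cast_eq_zero_iff k p]⟩

/-- A relation of minimal degree has a nonzero partial derivative; by minimality that derivative,
having smaller degree, is not a relation. -/
theorem exists_aeval_pderiv_ne_zero [PerfectField k]
    (hmin : ∀ g : MvPolynomial ι k, g ≠ 0 → aeval l g = 0 → f.totalDegree ≤ g.totalDegree)
    (hf : f ≠ 0) (hfl : aeval l f = 0) : ∃ i, aeval l (pderiv i f) ≠ 0 := by
  obtain ⟨i, s, hs, hi⟩ := exists_mem_support_natCast_ne_zero hmin hf hfl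
  have hpos : s i ≠ 0 := fun h ↦ hi (by rw [h, Nat.cast_zero])
  exact ⟨i, fun h ↦ (totalDegree_pderiv_lt hs hpos).not_ge
    (hmin _ (pderiv_ne_zero_of_natCast_ne_zero hs hi) h)⟩

end MinimalRelation

theorem exists_eval_ne_zero_and_sum_smul_ne_zero {k ι V : Type*} [Field k] [Infinite k]
    [Fintype ι] [AddCommGroup V] [Module k V] {h : MvPolynomial ι k} (hh : h ≠ 0) {v : ι → V}
    {i : ι} (hv : v i ≠ 0) : ∃ a : ι → k, eval a h ≠ 0 ∧ ∑ j, a j • v j ≠ 0 := by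
  classical
  obtain ⟨φ, hφ⟩ := Module.Projective.exists_dual_ne_zero k hv
  have heval (a : ι → k) : eval a (∑ j, C (φ (v j)) * X j) = φ (∑ j, a j • v j) := by
    simp [mul_comm]
  have hq : ∑ j, C (φ (v j)) * X j ≠ (0 : MvPolynomial ι k) := fun h0 ↦ hφ <| by
    have := heval (Pi.single i 1)
    rw [h0, map_zero] at this
    simpa [Pi.single_apply] using this.symm
  obtain ⟨a, ha⟩ : ∃ a : ι → k, eval a (h * ∑ j, C (φ (v j)) * X j) ≠ 0 := by
    by_contra! h0
    exact mul_ne_zero hh hq (MvPolynomial.funext fun a ↦ by rw [h0, map_zero])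
  rw [map_mul, heval] at ha
  exact ⟨a, left_ne_zero_of_mul ha, fun h0 ↦ right_ne_zero_of_mul ha (by rw [h0, map_zero])⟩

section NoetherNormalization

theorem isIntegral_of_aeval_eq_zero_of_isUnit_coeff {A L : Type*} [CommRing A] [Ring L]
    [Algebra A L] {w : L} {g : Polynomial A} {e : ℕ} (hg : Polynomial.aeval w g = 0)
    (he : g.natDegree ≤ e) (hu : IsUnit (g.coeff e)) : IsIntegral A w := by
  obtain ⟨u, hu⟩ := hu.exists_left_inv
  refine ⟨Polynomial.C u * g, Polynomial.monic_of_natDegree_le_of_coeff_eq_one e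
    ((Polynomial.natDegree_C_mul_le _ _).trans he) (by rw [Polynomial.coeff_C_mul, hu]), ?_⟩
  rw [← Polynomial.aeval_def, map_mul, hg, mul_zero]

theorem isSeparable_of_aeval_derivative_ne_zero {K L : Type*} [Field K] [CommRing L] [IsDomain L]
    [Algebra K L] {w : L} {g : Polynomial K} (hg : Polynomial.aeval w g = 0)
    (hg' : Polynomial.aeval w (Polynomial.derivative g) ≠ 0) : IsSeparable K w := by
  have hg0 : g ≠ 0 := by
    rintro rfl
    exact hg' (by rw [Polynomial.derivative_zero, map_zero])
  have hint : IsIntegral K w := isAlgebraic_iff_isIntegral.mp ⟨g, hg0, hg⟩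
  obtain ⟨h, rfl⟩ := minpoly.dvd K w hg
  rw [IsSeparable, Polynomial.separable_iff_derivative_ne_zero (minpoly.irreducible hint)]
  intro h0
  rw [Polynomial.derivative_mul, h0, zero_mul, zero_add, map_mul, minpoly.aeval, zero_mul] at hg'
  exact hg' rfl

section Line

variable {k L ι B : Type*} [Field k] [CommRing L] [Algebra k L] {a : ι → k} {w : L}
  {f : MvPolynomial ι k}

theorem isIntegral_of_relation_on_line [CommRing B] [Algebra k B] [Algebra B L]
    [IsScalarTower k B L] (b : ι → B) (hf : aeval (fun j ↦ algebraMap B L (b j) + a j • w) f = 0)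
    (ha : eval a (homogeneousComponent f.totalDegree f) ≠ 0) : IsIntegral B w := by
  refine isIntegral_of_aeval_eq_zero_of_isUnit_coeff (g := lineSubst b a f)
    ((aeval_lineSubst b a w f).trans hf) (natDegree_lineSubst_le b a f) ?_
  rw [coeff_totalDegree_lineSubst]
  exact (isUnit_iff_ne_zero.mpr ha).map _

theorem isSeparable_of_relation_on_line [IsDomain L] [Fintype ι] [Field B] [Algebra k B]
    [Algebra B L] [IsScalarTower k B L] (b : ι → B)
    (hf : aeval (fun j ↦ algebraMap B L (b j) + a j • w) f = 0)
    (ha : ∑ j, a j • aeval (fun j ↦ algebraMap B L (b j) + a j • w) (pderiv j f) ≠ 0) :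
    IsSeparable B w := by
  refine isSeparable_of_aeval_derivative_ne_zero (g := lineSubst b a f)
    ((aeval_lineSubst b a w f).trans hf) ?_
  rw [derivative_lineSubst, map_sum]
  simpa only [map_mul, aeval_lineSubst, Polynomial.aeval_C, ← IsScalarTower.algebraMap_apply,
    ← Algebra.smul_def] using ha

end Line

variable {k L : Type*} [Field k] [Field L] [Algebra k L] {S T U : Set L}

variable (k S T) in
/-- Every element of `T` is integral over `k[S]` and separable over `k(S)`: the relation that each
step of the normalization has to preserve. -/
def IsIntegralSeparableOver : Prop :=
  (∀ v ∈ T, IsIntegral (Algebra.adjoin k S) v) ∧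
    ∀ v ∈ T, IsSeparable (IntermediateField.adjoin k S) v

theorem isIntegralSeparableOver_self (S : Set L) : IsIntegralSeparableOver k S S :=
  ⟨fun v hv ↦ isIntegral_algebraMap (x := (⟨v, Algebra.subset_adjoin hv⟩ : Algebra.adjoin k S)),
    fun v hv ↦ isSeparable_algebraMap
      (⟨v, IntermediateField.subset_adjoin k S hv⟩ : IntermediateField.adjoin k S)⟩

theorem IsIntegralSeparableOver.mono (h : IsIntegralSeparableOver k S T) (hU : U ⊆ T) :
    IsIntegralSeparableOver k S U :=
  ⟨fun v hv ↦ h.1 v (hU hv), fun v hv ↦ h.2 v (hU hv)⟩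

theorem IsIntegralSeparableOver.insert (h : IsIntegralSeparableOver k S T) {w : L}
    (hint : IsIntegral (Algebra.adjoin k S) w)
    (hsep : IsSeparable (IntermediateField.adjoin k S) w) :
    IsIntegralSeparableOver k S (insert w T) :=
  ⟨Set.forall_mem_insert.mpr ⟨hint, h.1⟩, Set.forall_mem_insert.mpr ⟨hsep, h.2⟩⟩

theorem IsIntegralSeparableOver.span (h : IsIntegralSeparableOver k S T) :
    IsIntegralSeparableOver k S (Submodule.span k T : Set L) := by
  have hint : Submodule.span k T ≤ Subalgebra.toSubmodule
      ((integralClosure (Algebra.adjoin k S) L).restrictScalars k) :=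
    Submodule.span_le.mpr h.1
  have hsep : Submodule.span k T ≤ Subalgebra.toSubmodule ((separableClosure
      (IntermediateField.adjoin k S) L).restrictScalars k).toSubalgebra :=
    Submodule.span_le.mpr fun v hv ↦ mem_separableClosure_iff.mpr (h.2 v hv)
  exact ⟨fun v hv ↦ hint hv, fun v hv ↦ mem_separableClosure_iff.mp (hsep hv)⟩

theorem IsIntegralSeparableOver.trans (hS : IsIntegralSeparableOver k S T)
    (hT : IsIntegralSeparableOver k T U) : IsIntegralSeparableOver k S U := by
  refine ⟨fun v hv ↦ ?_, fun v hv ↦ ?_⟩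
  · have hle : Algebra.adjoin k T ≤
        (integralClosure (Algebra.adjoin k S) L).restrictScalars k :=
      Algebra.adjoin_le hS.1
    exact isIntegral_trans (A := integralClosure (Algebra.adjoin k S) L) v <|
      (hT.1 v hv).map_of_comp_eq (Subalgebra.inclusion hle).toRingHom (RingHom.id L) rfl
  · have hle : IntermediateField.adjoin k T ≤
        (separableClosure (IntermediateField.adjoin k S) L).restrictScalars k :=
      IntermediateField.adjoin_le_iff.mpr fun x hx ↦ mem_separableClosure_iff.mpr (hS.2 x hx)
    exact mem_separableClosure_iff.mp <|
      (separableClosure_le_separableClosure_iff k L _).mpr hle <|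
        mem_separableClosure_iff.mpr (hT.2 v hv)

/-- Removing the direction `w` from the dependent elements `l j` leaves the elements
`l j - a j • w`; the relation `f`, restricted to the line they span with `w`, is an equation
for `w`. -/
theorem isIntegralSeparableOver_of_relation {ι : Type*} [Fintype ι] {l : ι → L} {a : ι → k}
    {w : L} (hS : ∀ j, l j - a j • w ∈ S) {f : MvPolynomial ι k} (hf : aeval l f = 0)
    (ha : eval a (homogeneousComponent f.totalDegree f) ≠ 0)
    (ha' : ∑ j, a j • aeval l (pderiv j f) ≠ 0) :
    IsIntegralSeparableOver k S (Set.range l) := by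
  have hl : (fun j ↦ l j - a j • w + a j • w) = l := funext fun j ↦ sub_add_cancel _ _
  have hint : IsIntegral (Algebra.adjoin k S) w :=
    isIntegral_of_relation_on_line (fun j ↦ ⟨_, Algebra.subset_adjoin (hS j)⟩)
      ((congrArg (aeval · f) hl).trans hf) ha
  have hsep : IsSeparable (IntermediateField.adjoin k S) w := by
    refine isSeparable_of_relation_on_line (a := a) (f := f)
      (fun j ↦ ⟨_, IntermediateField.subset_adjoin k S (hS j)⟩) ?_ ?_
    · exact (congrArg (aeval · f) hl).trans hf
    · exact (congrArg (fun x ↦ ∑ j, a j • aeval x (pderiv j f)) hl).trans_ne ha'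
  refine ((isIntegralSeparableOver_self S).insert hint hsep).span.mono ?_
  rintro _ ⟨j, rfl⟩
  rw [← sub_add_cancel (l j) (a j • w)]
  exact Submodule.add_mem _ (Submodule.subset_span (Or.inr (hS j)))
    (Submodule.smul_mem _ _ (Submodule.subset_span (Or.inl rfl)))

theorem exists_finrank_lt_forall_sub_smul_mem {k V ι : Type*} [Field k] [AddCommGroup V]
    [Module k V] [Fintype ι] (l : ι → V) {a : ι → k} (ha : a ≠ 0) :
    ∃ (w : V) (W : Submodule k V), W ≤ Submodule.span k (Set.range l) ∧
      Module.finrank k W < Fintype.card ι ∧ ∀ j, l j - a j • w ∈ W := by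
  classical
  obtain ⟨i, hi⟩ := Function.ne_iff.mp ha
  let l' (j : ι) : V := l j - a j • (a i)⁻¹ • l i
  have hi' : l' i = 0 := by simp only [l', smul_smul, mul_inv_cancel₀ hi, one_smul, sub_self]
  refine ⟨(a i)⁻¹ • l i, Submodule.span k (Set.range fun j : {j // j ≠ i} ↦ l' j),
    Submodule.span_le.mpr ?_, ?_, fun j ↦ ?_⟩
  · rintro _ ⟨j, rfl⟩
    exact Submodule.sub_mem _ (Submodule.subset_span ⟨_, rfl⟩)
      (Submodule.smul_mem _ _ (Submodule.smul_mem _ _ (Submodule.subset_span ⟨_, rfl⟩)))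
  · exact (finrank_range_le_card _).trans_lt (Fintype.card_subtype_lt (x := i) (by simp))
  · obtain rfl | hj := eq_or_ne j i
    · change l' j ∈ _
      rw [hi']
      exact Submodule.zero_mem _
    · exact Submodule.subset_span ⟨⟨j, hj⟩, rfl⟩

theorem exists_isIntegralSeparableOver_of_not_algebraicIndependent [Infinite k] [PerfectField k]
    {ι : Type*} [Fintype ι] {l : ι → L} (hl : ¬ AlgebraicIndependent k l) :
    ∃ W : Submodule k L, W ≤ Submodule.span k (Set.range l) ∧
      Module.finrank k W < Fintype.card ι ∧
      IsIntegralSeparableOver k (W : Set L) (Set.range l) := by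
  obtain ⟨f, hf, hfl, hmin⟩ := exists_relation_totalDegree_le hl
  obtain ⟨i, hi⟩ := exists_aeval_pderiv_ne_zero hmin hf hfl
  obtain ⟨a, ha, ha'⟩ := exists_eval_ne_zero_and_sum_smul_ne_zero
    (homogeneousComponent_totalDegree_ne_zero hf) (v := fun j ↦ aeval l (pderiv j f)) hi
  have ha0 : a ≠ 0 := by
    rintro rfl
    simp at ha'
  obtain ⟨w, W, hW, hlt, hmem⟩ := exists_finrank_lt_forall_sub_smul_mem l ha0
  exact ⟨W, hW, hlt, isIntegralSeparableOver_of_relation hmem hfl ha ha'⟩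

/-- Noether normalization, with a separable extension of function fields. A subspace `W ≤ V` of
minimal dimension with `V` integral and separable over it has an algebraically independent basis. -/
theorem exists_algebraicIndependent_isIntegralSeparableOver [Infinite k] [PerfectField k]
    (V : Submodule k L) [FiniteDimensional k V] :
    ∃ (s : ℕ) (l : Fin s → L), (∀ i, l i ∈ V) ∧ AlgebraicIndependent k l ∧
      IsIntegralSeparableOver k (Set.range l) (V : Set L) := by
  obtain ⟨W, ⟨hWV, hW⟩, hmin⟩ :=
    (InvImage.wf (fun W : Submodule k L ↦ Module.finrank k W) wellFounded_lt).has_min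
      {W | W ≤ V ∧ IsIntegralSeparableOver k (W : Set L) (V : Set L)}
      ⟨V, le_rfl, isIntegralSeparableOver_self _⟩
  have : FiniteDimensional k W := Submodule.finiteDimensional_of_le hWV
  let b (i : Fin (Module.finrank k W)) : L := Module.finBasis k W i
  have hspan : Submodule.span k (Set.range b) = W := by
    have h := congrArg (Submodule.map W.subtype) (Module.finBasis k W).span_eq
    rwa [Submodule.map_span, Submodule.map_top, Submodule.range_subtype, ← Set.range_comp] at h
  have hb := (isIntegralSeparableOver_self (k := k) (Set.range b)).span
  rw [hspan] at hb
  refine ⟨_, b, fun i ↦ hWV (Module.finBasis k W i).2, ?_, hb.trans hW⟩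
  by_contra hdep
  obtain ⟨W', hW', hlt, hint⟩ :=
    exists_isIntegralSeparableOver_of_not_algebraicIndependent hdep
  have hint' := hint.span
  rw [hspan] at hW' hint'
  exact hmin W' ⟨hW'.trans hWV, hint'.trans hW⟩ (hlt.trans_eq (Fintype.card_fin _))

end NoetherNormalization

theorem ringKrullDim_eq_of_isIntegral (A B : Type*) [CommRing A] [CommRing B] [Algebra A B]
    [FaithfulSMul A B] [Algebra.IsIntegral A B] : ringKrullDim B = ringKrullDim A := by
  refine le_antisymm (Order.krullDim_le_of_strictMono (PrimeSpectrum.comap (algebraMap A B))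
    fun P Q h ↦ Ideal.IsIntegral.comap_lt_comap (R := A) h) (iSup_le fun l ↦ ?_)
  obtain ⟨⟨Q, hQ, hQl⟩⟩ := l.head.asIdeal.nonempty_primesOver (S := B)
  obtain ⟨l', hl', -⟩ := Ideal.exists_ltSeries_of_hasGoingUp l Q
  rw [← hl']
  exact Order.LTSeries.length_le_krullDim l'

section Forms

variable {k L ι κ : Type*} [CommRing k] [CommRing L] [Algebra k L] {x : ι → L} {m : ℕ} {y : L}

variable (k) in
/-- The space of values at the point `x` of the forms of degree `m`, which models the degree `m`
part of the homogeneous coordinate ring of a variety with generic point `x`. -/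
noncomputable def formsAt (x : ι → L) (m : ℕ) : Submodule k L :=
  (homogeneousSubmodule ι k m).map (aeval x).toLinearMap

theorem mem_formsAt : y ∈ formsAt k x m ↔
    ∃ f : MvPolynomial ι k, f.IsHomogeneous m ∧ aeval x f = y := Iff.rfl

instance [Finite ι] (x : ι → L) (m : ℕ) : Module.Finite k (formsAt k x m) := by
  unfold formsAt
  infer_instance

theorem mul_mem_formsAt {a b : ℕ} {z : L} (hy : y ∈ formsAt k x a) (hz : z ∈ formsAt k x b) :
    y * z ∈ formsAt k x (a + b) := by
  obtain ⟨f, hf, rfl⟩ := mem_formsAt.mp hy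
  obtain ⟨g, hg, rfl⟩ := mem_formsAt.mp hz
  exact ⟨f * g, hf.mul hg, map_mul (aeval x) f g⟩

theorem pow_mem_formsAt (hy : y ∈ formsAt k x m) (i : ℕ) : y ^ i ∈ formsAt k x (m * i) := by
  obtain ⟨f, hf, rfl⟩ := mem_formsAt.mp hy
  exact ⟨f ^ i, hf.pow i, map_pow (aeval x) f i⟩

theorem span_range_le_formsAt_one (x : ι → L) :
    Submodule.span k (Set.range x) ≤ formsAt k x 1 := by
  rw [Submodule.span_le]
  rintro _ ⟨i, rfl⟩
  exact ⟨X i, isHomogeneous_X k i, aeval_X _ _⟩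

theorem aeval_aeval {K : Type*} [CommRing K] [Algebra k K] [Algebra K L] [IsScalarTower k K L]
    {l : κ → K} {p : κ → MvPolynomial ι k} (hp : ∀ i, aeval x (p i) = algebraMap K L (l i))
    (f : MvPolynomial κ k) : aeval x (aeval p f) = algebraMap K L (aeval l f) := by
  rw [← AlgHom.comp_apply, comp_aeval, ← aeval_algebraMap_apply]
  exact congrArg (aeval · f) (funext hp)

theorem algebraMap_mem_formsAt {K : Type*} [CommRing K] [Algebra k K] [Algebra K L]
    [IsScalarTower k K L] {l : κ → K} (hl : ∀ i, algebraMap K L (l i) ∈ formsAt k x 1) {c : K}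
    (hc : c ∈ formsAt k l m) : algebraMap K L c ∈ formsAt k x m := by
  choose p hp hpl using fun i ↦ mem_formsAt.mp (hl i)
  obtain ⟨f, hf, rfl⟩ := mem_formsAt.mp hc
  exact ⟨aeval p f, by simpa using IsHomogeneous.aeval hf p hp, aeval_aeval hpl f⟩

theorem finrank_formsAt_le [Nontrivial k] {d : ℕ} (l : Fin (d + 1) → L) (m : ℕ) :
    Module.finrank k (formsAt k l m) ≤ (m + d).choose d := by
  rw [← finrank_homogeneousSubmodule_fin (R := k)]
  exact Submodule.finrank_map_le _ _

theorem finrank_formsAt_of_algebraicIndependent [Nontrivial k] {d : ℕ} {l : Fin (d + 1) → L}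
    (hl : AlgebraicIndependent k l) (m : ℕ) :
    Module.finrank k (formsAt k l m) = (m + d).choose d := by
  rw [← finrank_homogeneousSubmodule_fin (R := k)]
  exact (Submodule.equivMapOfInjective (aeval l).toLinearMap hl _).finrank_eq.symm

theorem homogeneousComponent_aeval {p : κ → MvPolynomial ι k} (hp : ∀ i, (p i).IsHomogeneous 1)
    (f : MvPolynomial κ k) (m : ℕ) :
    homogeneousComponent m (aeval p f) = aeval p (homogeneousComponent m f) := by
  have h (i : ℕ) : (aeval p (homogeneousComponent i f)).IsHomogeneous i := by
    simpa using IsHomogeneous.aeval (homogeneousComponent_isHomogeneous i f) p hp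
  conv_lhs => rw [← sum_homogeneousComponent f, map_sum, map_sum]
  rw [Finset.sum_congr rfl fun i _ ↦ homogeneousComponent_of_mem (h i), Finset.sum_ite_eq]
  refine ite_eq_left_iff.mpr fun hm ↦ ?_
  rw [homogeneousComponent_eq_zero _ _ (by simpa using hm), map_zero]

variable (k x) in
/-- The relations between the coordinates of the point `x` form a homogeneous ideal, so that `x` is
the generic point of a cone. -/
def HasHomogeneousRelations : Prop :=
  ∀ f : MvPolynomial ι k, aeval x f = 0 → ∀ m, aeval x (homogeneousComponent m f) = 0

theorem HasHomogeneousRelations.pow_add_sum_eq_zero (hx : HasHomogeneousRelations k x)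
    (hy : y ∈ formsAt k x m) {N : ℕ} {g : ℕ → MvPolynomial ι k}
    (h : y ^ N + ∑ j ∈ Finset.range N, y ^ j * aeval x (g j) = 0) :
    y ^ N + ∑ j ∈ Finset.range N,
      y ^ j * aeval x (homogeneousComponent ((N - j) * m) (g j)) = 0 := by
  obtain ⟨σ, hσ, rfl⟩ := mem_formsAt.mp hy
  have hcomp {j : ℕ} (hj : j ∈ Finset.range N) : homogeneousComponent (m * N) (σ ^ j * g j) =
      σ ^ j * homogeneousComponent ((N - j) * m) (g j) := by
    rw [← homogeneousComponent_mul_of_isHomogeneous (hσ.pow j), mul_comm (N - j), ← mul_add,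
      Nat.add_sub_cancel' (Finset.mem_range.mp hj).le]
  have hx' := hx (σ ^ N + ∑ j ∈ Finset.range N, σ ^ j * g j) (by simpa using h) (m * N)
  rw [map_add, homogeneousComponent_eq_self (hσ.pow N), map_sum,
    Finset.sum_congr rfl fun j hj ↦ hcomp hj] at hx'
  simpa using hx'

end Forms

section MinpolyCoeff

theorem pow_natDegree_minpoly_add_sum_eq_zero {K L : Type*} [CommRing K] [CommRing L] [Algebra K L]
    {y : L} (hy : IsIntegral K y) :
    y ^ (minpoly K y).natDegree + ∑ j ∈ Finset.range (minpoly K y).natDegree,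
      y ^ j * algebraMap K L ((minpoly K y).coeff j) = 0 := by
  have h := minpoly.aeval K y
  rw [Polynomial.aeval_eq_sum_range, Finset.sum_range_succ, (minpoly.monic hy).coeff_natDegree,
    one_smul, add_comm] at h
  simpa only [Algebra.smul_def, mul_comm] using h

theorem minpoly_coeff_eq_of_pow_add_sum_eq_zero {K L : Type*} [Field K] [CommRing L] [Algebra K L]
    {y : L} (hy : IsIntegral K y) {c : ℕ → K}
    (h : y ^ (minpoly K y).natDegree + ∑ j ∈ Finset.range (minpoly K y).natDegree,
      y ^ j * algebraMap K L (c j) = 0) {j : ℕ} (hj : j < (minpoly K y).natDegree) :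
    (minpoly K y).coeff j = c j := by
  have hsum := (pow_natDegree_minpoly_add_sum_eq_zero hy).trans h.symm
  rw [add_right_inj, ← sub_eq_zero, ← Finset.sum_sub_distrib, Finset.sum_range] at hsum
  refine sub_eq_zero.mp (Fintype.linearIndependent_iff.mp (linearIndependent_pow (K := K) y)
    (fun i ↦ (minpoly K y).coeff i - c i) ?_ ⟨j, hj⟩)
  simpa only [Algebra.smul_def, map_sub, mul_sub, mul_comm] using hsum

theorem HasHomogeneousRelations.minpoly_coeff_mem_formsAt {k K L ι κ : Type*} [CommRing k]
    [Field K] [CommRing L] [Algebra k K] [Algebra k L] [Algebra K L] [IsScalarTower k K L]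
    {x : ι → L} {l : κ → K} (hx : HasHomogeneousRelations k x)
    (hl : ∀ i, algebraMap K L (l i) ∈ formsAt k x 1) {m : ℕ} {y : L} (hy : y ∈ formsAt k x m)
    (hint : IsIntegral K y) (hcoeff : ∀ j, (minpoly K y).coeff j ∈ Algebra.adjoin k (Set.range l))
    {j : ℕ} (hj : j < (minpoly K y).natDegree) :
    (minpoly K y).coeff j ∈ formsAt k l (((minpoly K y).natDegree - j) * m) := by
  rw [Algebra.adjoin_range_eq_range_aeval] at hcoeff
  choose α hα using hcoeff
  replace hα (j : ℕ) : aeval l (α j) = (minpoly K y).coeff j := hα j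
  choose p hp hpl using fun i ↦ mem_formsAt.mp (hl i)
  have hrel := pow_natDegree_minpoly_add_sum_eq_zero hint
  simp only [← hα, ← aeval_aeval hpl] at hrel
  have hrel' := hx.pow_add_sum_eq_zero hy hrel
  simp only [homogeneousComponent_aeval hp, aeval_aeval hpl] at hrel'
  rw [minpoly_coeff_eq_of_pow_add_sum_eq_zero hint hrel' hj]
  exact ⟨_, homogeneousComponent_isHomogeneous _ _, rfl⟩

end MinpolyCoeff

section Bounds

open IntermediateField

variable {k K L : Type*} [Field k] [Field K] [Field L] [Algebra k K] [Algebra k L] [Algebra K L]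

theorem exists_mem_adjoin_simple_eq_top [Infinite k] [IsScalarTower k K L] [FiniteDimensional K L]
    [Algebra.IsSeparable K L] (V : Submodule k L) (hV : adjoin K (V : Set L) = ⊤) :
    ∃ u ∈ V, K⟮u⟯ = ⊤ := by
  have : Finite (IntermediateField K L) :=
    (Field.exists_primitive_element_iff_finite_intermediateField K L).mp
      ⟨inferInstance, Field.exists_primitive_element K L⟩
  by_contra! h
  let p (E : {E : IntermediateField K L // E ≠ ⊤}) : Subspace k V :=
    Submodule.comap V.subtype ((Subalgebra.toSubmodule E.1.toSubalgebra).restrictScalars k)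
  have hcover : ⋃ E, (p E : Set V) = Set.univ := Set.eq_univ_iff_forall.mpr fun u ↦
    Set.mem_iUnion.mpr ⟨⟨K⟮(u : L)⟯, h u u.2⟩, mem_adjoin_simple_self K _⟩
  obtain ⟨E, hE⟩ := Subspace.exists_eq_top_of_iUnion_eq_univ hcover
  refine E.2 (eq_top_iff.mpr (hV.ge.trans (adjoin_le_iff.mpr fun v hv ↦ ?_)))
  have hvE : (⟨v, hv⟩ : V) ∈ p E := hE ▸ Submodule.mem_top
  exact hvE

theorem isIntegral_aeval {k A L ι : Type*} [CommRing k] [CommRing A] [CommRing L] [Algebra k A]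
    [Algebra k L] [Algebra A L] [IsScalarTower k A L] {x : ι → L} (hx : ∀ i, IsIntegral A (x i))
    (f : MvPolynomial ι k) : IsIntegral A (aeval x f) := by
  have h : Algebra.adjoin k (Set.range x) ≤ (integralClosure A L).restrictScalars k :=
    Algebra.adjoin_le (Set.range_subset_iff.mpr hx)
  rw [Algebra.adjoin_range_eq_range_aeval] at h
  exact h ⟨f, rfl⟩

theorem finrank_mul_choose_le_finrank_formsAt {ι : Type*} [Finite ι] {d : ℕ}
    [IsScalarTower k K L] [FiniteDimensional K L] {x : ι → L} {l : Fin (d + 1) → K}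
    (hlx : ∀ i, algebraMap K L (l i) ∈ formsAt k x 1) (hl : AlgebraicIndependent k l)
    {u : L} (hu : u ∈ formsAt k x 1) (hutop : K⟮u⟯ = ⊤) (m : ℕ) :
    Module.finrank K L * (m + d).choose d ≤
      Module.finrank k (formsAt k x (m + Module.finrank K L)) := by
  rw [← (Field.primitive_element_iff_minpoly_natDegree_eq K u).mp hutop]
  set r := (minpoly K u).natDegree
  let S : (Fin r → K) →ₗ[k] L :=
    (Fintype.linearCombination K fun i : Fin r ↦ u ^ (i : ℕ)).restrictScalars k
  let T : (∀ i : Fin r, formsAt k l (m + (r - i))) →ₗ[k] L :=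
    S ∘ₗ LinearMap.pi fun i ↦ (formsAt k l _).subtype ∘ₗ LinearMap.proj i
  have hTx (c) : T c ∈ formsAt k x (m + r) := by
    suffices ∑ i, (c i : K) • u ^ (i : ℕ) ∈ formsAt k x (m + r) from this
    refine Submodule.sum_mem _ fun i _ ↦ ?_
    have hmul := mul_mem_formsAt (algebraMap_mem_formsAt hlx (c i).2) (pow_mem_formsAt hu i)
    rw [one_mul, add_assoc, Nat.sub_add_cancel i.2.le, ← Algebra.smul_def] at hmul
    exact hmul
  have hinj : Function.Injective T := fun c c' h ↦ by
    have hcoe := (linearIndependent_pow (K := K) u).fintypeLinearCombination_injective h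
    exact funext fun i ↦ Subtype.ext (congrFun hcoe i)
  calc r * (m + d).choose d = ∑ _i : Fin r, (m + d).choose d := by simp
    _ ≤ ∑ i : Fin r, (m + (r - i) + d).choose d :=
      Finset.sum_le_sum fun i _ ↦ Nat.choose_le_choose d (by omega)
    _ = Module.finrank k (∀ i : Fin r, formsAt k l (m + (r - i))) := by
      rw [Module.finrank_pi_fintype]
      exact Finset.sum_congr rfl fun i _ ↦ (finrank_formsAt_of_algebraicIndependent hl _).symm
    _ ≤ Module.finrank k (formsAt k x (m + r)) :=
      LinearMap.finrank_le_finrank_of_injective (f := T.codRestrict _ hTx)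
        fun c c' h ↦ hinj (congrArg Subtype.val h)

section Trace

variable {A ι κ : Type*} [CommRing A] [IsIntegrallyClosed A] [Algebra A K] [IsFractionRing A K]
  [Algebra A L] [IsScalarTower A K L] [IsScalarTower k K L]
  {x : ι → L} {l : κ → K} {m : ℕ}

theorem HasHomogeneousRelations.trace_mem_formsAt [FiniteDimensional K L]
    (hx : HasHomogeneousRelations k x)
    (hlx : ∀ i, algebraMap K L (l i) ∈ formsAt k x 1)
    (hA : ∀ a, algebraMap A K a ∈ Algebra.adjoin k (Set.range l)) {y : L}
    (hy : y ∈ formsAt k x m) (hyA : IsIntegral A y) : Algebra.trace K L y ∈ formsAt k l m := by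
  have : IsDomain A := (IsFractionRing.injective A K).isDomain
  have hyK : IsIntegral K y := hyA.tower_top
  have hpos := minpoly.natDegree_pos hyK
  have hcoeff := hx.minpoly_coeff_mem_formsAt hlx hy hyK (fun j ↦ by
    rw [minpoly.isIntegrallyClosed_eq_field_fractions' K hyA, Polynomial.coeff_map]
    exact hA _) (Nat.sub_lt hpos one_pos)
  rw [Nat.sub_sub_self (show 1 ≤ _ from hpos), one_mul] at hcoeff
  rw [trace_eq_finrank_mul_minpoly_nextCoeff, Polynomial.nextCoeff_of_natDegree_pos hpos,
    ← nsmul_eq_mul]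
  exact Submodule.smul_of_tower_mem _ _ (neg_mem hcoeff)

theorem eq_zero_of_forall_trace_mul_pow_eq_zero [FiniteDimensional K L] [Algebra.IsSeparable K L]
    {u : L} (hu : K⟮u⟯ = ⊤) {y : L}
    (hy : ∀ i < Module.finrank K L, Algebra.trace K L (y * u ^ i) = 0) : y = 0 := by
  have hr := (Field.primitive_element_iff_minpoly_natDegree_eq K u).mp hu
  have hspan : Submodule.span K (Set.range fun i : Fin (minpoly K u).natDegree ↦ u ^ (i : ℕ)) = ⊤ :=
    (linearIndependent_pow u).span_eq_top_of_card_eq_finrank' (by simpa using hr)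
  have hle : ⊤ ≤ LinearMap.ker (Algebra.traceForm K L y) := by
    rw [← hspan, Submodule.span_le]
    rintro _ ⟨i, rfl⟩
    exact hy i (hr ▸ i.2)
  exact (traceForm_nondegenerate K L).1 y fun z ↦ hle Submodule.mem_top

theorem HasHomogeneousRelations.finrank_formsAt_le_sum [Algebra k A] [IsScalarTower k A L]
    [FiniteDimensional K L] [Algebra.IsSeparable K L] {d : ℕ} {l : Fin (d + 1) → K}
    (hx : HasHomogeneousRelations k x) (hxA : ∀ i, IsIntegral A (x i))
    (hlx : ∀ i, algebraMap K L (l i) ∈ formsAt k x 1)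
    (hA : ∀ a, algebraMap A K a ∈ Algebra.adjoin k (Set.range l))
    {u : L} (hu : u ∈ formsAt k x 1) (hutop : K⟮u⟯ = ⊤) (m : ℕ) :
    Module.finrank k (formsAt k x m) ≤
      ∑ i ∈ Finset.range (Module.finrank K L), (m + i + d).choose d := by
  let T (i : ℕ) : formsAt k x m →ₗ[k] K :=
    (Algebra.trace K L).restrictScalars k ∘ₗ LinearMap.mulRight k (u ^ i) ∘ₗ
      (formsAt k x m).subtype
  have hT (i : Fin (Module.finrank K L)) (y) : T i y ∈ formsAt k l (m + i) := by
    have hyu := mul_mem_formsAt y.2 (pow_mem_formsAt hu i)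
    rw [one_mul] at hyu
    obtain ⟨f, -, hf⟩ := mem_formsAt.mp hyu
    exact hx.trace_mem_formsAt hlx hA hyu (hf.subst (isIntegral_aeval hxA f))
  have hinj : Function.Injective (LinearMap.pi fun i : Fin _ ↦ (T i).codRestrict _ (hT i)) :=
    (injective_iff_map_eq_zero _).mpr fun y hy ↦ Subtype.ext <|
      eq_zero_of_forall_trace_mul_pow_eq_zero hutop fun i hi ↦
        congrArg Subtype.val (congrFun hy ⟨i, hi⟩)
  calc Module.finrank k (formsAt k x m)
    _ ≤ ∑ i : Fin (Module.finrank K L), Module.finrank k (formsAt k l (m + i)) := by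
      rw [← Module.finrank_pi_fintype]
      exact LinearMap.finrank_le_finrank_of_injective hinj
    _ ≤ ∑ i : Fin (Module.finrank K L), (m + i + d).choose d :=
      Finset.sum_le_sum fun i _ ↦ finrank_formsAt_le l _
    _ = _ := Fin.sum_univ_eq_sum_range (fun i ↦ (m + i + d).choose d) _

end Trace

end Bounds

section Prime

open IntermediateField IntermediateField.algebraAdjoinAdjoin

theorem ringKrullDim_range_aeval_of_isIntegral {k L ι : Type*} [Field k] [CommRing L]
    [Algebra k L] {s : ℕ} {x : ι → L} {l : Fin s → L} (hl : AlgebraicIndependent k l)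
    (hlx : ∀ i, l i ∈ (aeval (R := k) x).range)
    (hx : ∀ i, IsIntegral (Algebra.adjoin k (Set.range l)) (x i)) :
    ringKrullDim (aeval (R := k) x).range = s := by
  have hle : Algebra.adjoin k (Set.range l) ≤ (aeval (R := k) x).range :=
    Algebra.adjoin_le (Set.range_subset_iff.mpr hlx)
  let _ : Algebra (Algebra.adjoin k (Set.range l)) (aeval (R := k) x).range :=
    (Subalgebra.inclusion hle).toAlgebra
  have : IsScalarTower (Algebra.adjoin k (Set.range l)) (aeval (R := k) x).range L :=
    .of_algebraMap_eq fun _ ↦ rfl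
  have : FaithfulSMul (Algebra.adjoin k (Set.range l)) (aeval (R := k) x).range :=
    (faithfulSMul_iff_algebraMap_injective _ _).mpr (Subalgebra.inclusion_injective hle)
  have : Algebra.IsIntegral (Algebra.adjoin k (Set.range l)) (aeval (R := k) x).range := by
    refine ⟨fun ⟨_, f, hf⟩ ↦ ?_⟩
    rw [← isIntegral_algebraMap_iff (B := L) Subtype.val_injective]
    exact hf.subst (isIntegral_aeval hx f)
  rw [ringKrullDim_eq_of_isIntegral (Algebra.adjoin k (Set.range l)),
    ← ringKrullDim_eq_of_ringEquiv hl.aevalEquiv.toRingEquiv,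
    MvPolynomial.ringKrullDim_of_isNoetherianRing, ringKrullDim_eq_zero_of_field, zero_add,
    Nat.card_fin]

theorem finiteDimensional_and_isSeparable_of_adjoin_eq_top {K L : Type*} [Field K] [Field L]
    [Algebra K L] {S : Set L} [Finite S] (hS : ∀ y ∈ S, IsSeparable K y) (htop : adjoin K S = ⊤) :
    FiniteDimensional K L ∧ Algebra.IsSeparable K L := by
  have hfin : FiniteDimensional K (adjoin K S) :=
    finiteDimensional_adjoin fun y hy ↦ (hS y hy).isIntegral
  have hsep : Algebra.IsSeparable K (adjoin K S) :=
    (isSeparable_adjoin_iff_isSeparable K L).mpr hS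
  rw [htop] at hfin hsep
  exact ⟨topEquiv.toLinearEquiv.finiteDimensional,
    .of_algHom K _ (topEquiv (F := K) (E := L)).symm.toAlgHom⟩

variable {k : Type*} [Field k]

theorem IsIntegralSeparableOver.exists_bounds {L ι : Type*} [Field L] [Algebra k L] [Infinite k]
    [Finite ι] {x : ι → L} (htop : adjoin k (Set.range x) = ⊤) (hx : HasHomogeneousRelations k x)
    {d : ℕ} {l : Fin (d + 1) → L} (hlx : ∀ i, l i ∈ formsAt k x 1) (hl : AlgebraicIndependent k l)
    (hxl : IsIntegralSeparableOver k (Set.range l) (Set.range x)) :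
    ∃ r : ℕ, ∀ m,
      Module.finrank k (formsAt k x m) ≤ ∑ i ∈ Finset.range r, (m + i + d).choose d ∧
      r * (m + d).choose d ≤ Module.finrank k (formsAt k x (m + r)) := by
  set K := adjoin k (Set.range l)
  have htopK : adjoin K (Set.range x) = ⊤ := by
    rw [← restrictScalars_eq_top_iff (K := k), eq_top_iff, ← htop, adjoin_le_iff]
    exact subset_adjoin K _
  obtain ⟨_, _⟩ := finiteDimensional_and_isSeparable_of_adjoin_eq_top
    (Set.forall_mem_range.mpr fun i ↦ hxl.2 _ ⟨i, rfl⟩) htopK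
  obtain ⟨u, huV, hu⟩ := exists_mem_adjoin_simple_eq_top (Submodule.span k (Set.range x))
    (eq_top_iff.mpr (htopK.ge.trans (adjoin.mono K _ _ Submodule.subset_span)))
  have hux := span_range_le_formsAt_one x huV
  have : IsIntegrallyClosed (Algebra.adjoin k (Set.range l)) :=
    .of_equiv hl.aevalEquiv.toRingEquiv
  let l' (i : Fin (d + 1)) : K := ⟨l i, subset_adjoin k _ ⟨i, rfl⟩⟩
  have hl' : AlgebraicIndependent k l' := .of_comp K.val hl
  refine ⟨Module.finrank K L, fun m ↦
    ⟨hx.finrank_formsAt_le_sum (A := Algebra.adjoin k (Set.range l)) (l := l')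
      (fun i ↦ hxl.1 _ ⟨i, rfl⟩) hlx (fun a ↦ ?_) hux hu m,
    finrank_mul_choose_le_finrank_formsAt (l := l') hlx hl' hux hu m⟩⟩
  obtain ⟨a, ha⟩ := a
  rw [Algebra.adjoin_range_eq_range_aeval] at ha ⊢
  obtain ⟨f, rfl⟩ := ha
  exact ⟨f, Subtype.ext (aeval_algebraMap_apply L l' f).symm⟩

theorem exists_bounds_of_adjoin_eq_top {L ι : Type*} [Field L] [Algebra k L] [Infinite k]
    [PerfectField k] [Finite ι] {x : ι → L} (htop : adjoin k (Set.range x) = ⊤)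
    (hx : HasHomogeneousRelations k x) {d : ℕ}
    (hd : ringKrullDim (aeval (R := k) x).range = d + 1) :
    ∃ r : ℕ, ∀ m,
      Module.finrank k (formsAt k x m) ≤ ∑ i ∈ Finset.range r, (m + i + d).choose d ∧
      r * (m + d).choose d ≤ Module.finrank k (formsAt k x (m + r)) := by
  have : FiniteDimensional k (Submodule.span k (Set.range x)) :=
    FiniteDimensional.span_of_finite k (Set.finite_range x)
  obtain ⟨s, l, hlV, hl, hVl⟩ :=
    exists_algebraicIndependent_isIntegralSeparableOver (Submodule.span k (Set.range x))
  have hxl := hVl.mono Submodule.subset_span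
  have hlx (i : Fin s) : l i ∈ formsAt k x 1 := span_range_le_formsAt_one x (hlV i)
  obtain rfl : s = d + 1 := by
    rw [ringKrullDim_range_aeval_of_isIntegral hl (fun i ↦ LinearMap.map_le_range (hlx i))
      fun i ↦ hxl.1 _ ⟨i, rfl⟩] at hd
    exact_mod_cast hd
  exact hxl.exists_bounds htop hx hlx hl

variable {n d : ℕ}

section GenericPoint

variable {ι : Type*} (Q : Ideal (MvPolynomial ι k))

/-- The generic point of the variety of the prime ideal `Q`: the point whose coordinates are the
images of the variables in the function field. -/
noncomputable def genericPoint (i : ι) : FractionRing (MvPolynomial ι k ⧸ Q) :=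
  algebraMap _ _ (Ideal.Quotient.mk Q (X i))

theorem aeval_genericPoint (f : MvPolynomial ι k) :
    aeval (genericPoint Q) f = algebraMap _ _ (Ideal.Quotient.mk Q f) := by
  have h : aeval (genericPoint Q) = (IsScalarTower.toAlgHom k (MvPolynomial ι k ⧸ Q)
      (FractionRing (MvPolynomial ι k ⧸ Q))).comp (Ideal.Quotient.mkₐ k Q) :=
    algHom_ext fun i ↦ aeval_X _ i
  exact congrArg (· f) h

theorem aeval_genericPoint_eq_zero_iff {f : MvPolynomial ι k} :
    aeval (genericPoint Q) f = 0 ↔ f ∈ Q := by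
  rw [aeval_genericPoint, ← Ideal.Quotient.eq_zero_iff_mem]
  exact map_eq_zero_iff _ (IsFractionRing.injective (MvPolynomial ι k ⧸ Q) _)

theorem adjoin_range_genericPoint [Q.IsPrime] : adjoin k (Set.range (genericPoint Q)) = ⊤ := by
  have hmem (a : MvPolynomial ι k ⧸ Q) :
      algebraMap _ (FractionRing _) a ∈ adjoin k (Set.range (genericPoint Q)) := by
    obtain ⟨f, rfl⟩ := Ideal.Quotient.mk_surjective a
    refine algebra_adjoin_le_adjoin k _ ?_
    rw [Algebra.adjoin_range_eq_range_aeval]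
    exact ⟨f, aeval_genericPoint Q f⟩
  refine eq_top_iff.mpr fun y _ ↦ ?_
  obtain ⟨a, b, -, rfl⟩ := IsFractionRing.div_surjective (A := MvPolynomial ι k ⧸ Q) y
  exact div_mem (hmem a) (hmem b)

theorem ringKrullDim_range_aeval_genericPoint :
    ringKrullDim (aeval (R := k) (genericPoint Q)).range =
      ringKrullDim (MvPolynomial ι k ⧸ Q) := by
  have hker : RingHom.ker (aeval (R := k) (genericPoint Q)) = Q :=
    SetLike.ext fun _ ↦ aeval_genericPoint_eq_zero_iff Q
  exact ringKrullDim_eq_of_ringEquiv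
    ((Ideal.quotientKerEquivRange _).symm.toRingEquiv.trans (Ideal.quotEquivOfEq hker))

theorem hasHomogeneousRelations_genericPoint
    (hQ : ∀ f ∈ Q, ∀ m, homogeneousComponent m f ∈ Q) :
    HasHomogeneousRelations k (genericPoint Q) := by
  simpa only [HasHomogeneousRelations, aeval_genericPoint_eq_zero_iff] using hQ

end GenericPoint

theorem hilbertFunction_eq_finrank_formsAt_genericPoint
    (Q : Ideal (MvPolynomial (Fin (n + 1)) k)) (m : ℕ) :
    hilbertFunction Q m = Module.finrank k (formsAt k (genericPoint Q) m) := by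
  have h : formsAt k (genericPoint Q) m = LinearMap.range
      ((aeval (genericPoint Q)).toLinearMap ∘ₗ (homogeneousSubmodule _ k m).subtype) := by
    rw [LinearMap.range_comp, Submodule.range_subtype, formsAt]
  rw [hilbertFunction_eq_finrank_range, h]
  refine finrank_range_eq_of_ker_eq _ _ (SetLike.ext fun f ↦ ?_)
  rw [mem_ker_formsToQuotient]
  exact (aeval_genericPoint_eq_zero_iff Q).symm

theorem exists_bounds_hilbertFunction_of_isPrime [Infinite k] [PerfectField k]
    {Q : Ideal (MvPolynomial (Fin (n + 1)) k)} [Q.IsPrime] (hQ : IsHomogeneousIdeal Q)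
    (hd : HasDim Q d) :
    ∃ r : ℕ, ∀ m,
      hilbertFunction Q m ≤ ∑ i ∈ Finset.range r, (m + i + d).choose d ∧
      r * (m + d).choose d ≤ hilbertFunction Q (m + r) := by
  simp only [hilbertFunction_eq_finrank_formsAt_genericPoint]
  exact exists_bounds_of_adjoin_eq_top (adjoin_range_genericPoint Q)
    (hasHomogeneousRelations_genericPoint Q (isHomogeneousIdeal_iff.mp hQ))
    ((ringKrullDim_range_aeval_genericPoint Q).trans hd)

end Prime

section EventuallyNonneg

open Filter
open scoped Polynomial

variable {𝕜 : Type*} [NormedField 𝕜] [LinearOrder 𝕜] [IsStrictOrderedRing 𝕜] [OrderTopology 𝕜]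
  [Archimedean 𝕜] {p q : 𝕜[X]}

theorem leadingCoeff_nonneg_of_eventually (h : ∀ᶠ m : ℕ in atTop, 0 ≤ p.eval (m : 𝕜)) :
    0 ≤ p.leadingCoeff := by
  by_contra! hlt
  by_cases hdeg : 0 < p.degree
  · have ht := (p.tendsto_atBot_of_leadingCoeff_nonpos hdeg hlt.le).comp
      (tendsto_natCast_atTop_atTop (R := 𝕜))
    obtain ⟨m, hm, hm'⟩ := ((ht.eventually (eventually_lt_atBot 0)).and h).exists
    exact hm.not_ge hm'
  · obtain ⟨m, hm⟩ := h.exists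
    rw [Polynomial.eq_C_of_degree_le_zero (not_lt.mp hdeg), Polynomial.eval_C] at hm
    rw [Polynomial.eq_C_of_degree_le_zero (not_lt.mp hdeg), Polynomial.leadingCoeff_C] at hlt
    exact hlt.not_ge hm

theorem coeff_le_coeff_of_eventually {d : ℕ} (hp : p.natDegree ≤ d) (hq : q.natDegree ≤ d)
    (h : ∀ᶠ m : ℕ in atTop, p.eval (m : 𝕜) ≤ q.eval (m : 𝕜)) : p.coeff d ≤ q.coeff d := by
  rw [← sub_nonneg, ← Polynomial.coeff_sub]
  obtain hlt | heq := (Polynomial.natDegree_sub_le_of_le hq hp).lt_or_eq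
  · rw [Polynomial.coeff_eq_zero_of_natDegree_lt (hlt.trans_le (max_self d).le)]
  · rw [max_self] at heq
    rw [← heq]
    exact leadingCoeff_nonneg_of_eventually
      (by simpa only [Polynomial.eval_sub, sub_nonneg] using h)

theorem natDegree_le_natDegree_of_eventually
    (h0 : ∀ᶠ m : ℕ in atTop, 0 ≤ p.eval (m : 𝕜))
    (hpq : ∀ᶠ m : ℕ in atTop, p.eval (m : 𝕜) ≤ q.eval (m : 𝕜)) : p.natDegree ≤ q.natDegree := by
  by_contra! hlt
  have hq : 0 ≤ (q - p).leadingCoeff :=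
    leadingCoeff_nonneg_of_eventually (by simpa only [Polynomial.eval_sub, sub_nonneg] using hpq)
  rw [Polynomial.leadingCoeff_sub_of_degree_lt' (Polynomial.degree_lt_degree hlt),
    Left.nonneg_neg_iff] at hq
  have hp : p = 0 := Polynomial.leadingCoeff_eq_zero.mp
    (hq.antisymm (leadingCoeff_nonneg_of_eventually h0))
  simp [hp] at hlt

end EventuallyNonneg

section ChooseSum

theorem sum_sum_choose_le {ι : Type*} (s : Finset ι) (r : ι → ℕ) (d m : ℕ) :
    ∑ j ∈ s, ∑ i ∈ Finset.range (r j), (m + i + d).choose d ≤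
      ∑ i ∈ Finset.range (∑ j ∈ s, r j), (m + i + d).choose d := by
  classical
  induction s using Finset.induction_on with
  | empty => simp
  | insert a s ha ih =>
    rw [Finset.sum_insert ha, Finset.sum_insert ha, add_comm (r a), Finset.sum_range_add, add_comm]
    exact add_le_add ih (Finset.sum_le_sum fun i _ ↦ Nat.choose_le_choose d (by lia))

theorem sum_choose_add_choose (d m r : ℕ) :
    ∑ i ∈ Finset.range r, (m + i + d).choose d + (m + d).choose (d + 1) =
      (m + r + d).choose (d + 1) := by
  induction r with
  | zero => simp
  | succ r ih =>
    rw [Finset.sum_range_succ, add_right_comm, ih, show m + (r + 1) + d = (m + r + d) + 1 by ring,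
      Nat.choose_succ_succ, add_comm]

end ChooseSum

section Degree

open Filter
open scoped Polynomial

variable {k : Type*} [Field k] {n d r : ℕ} {I : Ideal (MvPolynomial (Fin (n + 1)) k)}

theorem eventually_eq_eval_hilbertPolynomial (hI : IsHomogeneousIdeal I) :
    ∀ᶠ m : ℕ in atTop, (hilbertFunction I m : ℚ) = (hilbertPolynomial I).eval (m : ℚ) := by
  obtain ⟨m₀, hm₀⟩ := isHilbertPolynomial_hilbertPolynomial hI
  exact eventually_atTop.mpr ⟨m₀, hm₀⟩

theorem natDegree_hilbertPolynomial_le (hI : IsHomogeneousIdeal I)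
    (h : ∀ m, hilbertFunction I m ≤ r * (m + r + d).choose d) :
    (hilbertPolynomial I).natDegree ≤ d := by
  let q : ℚ[X] :=
    (r : ℚ) • (Polynomial.preHilbertPoly ℚ d 0).comp (Polynomial.X + Polynomial.C (r : ℚ))
  have hq (m : ℕ) : q.eval (m : ℚ) = r * (m + r + d).choose d := by
    have heval := Polynomial.preHilbertPoly_eq_choose_sub_add ℚ d (Nat.zero_le (m + r))
    rw [Nat.sub_zero, Nat.cast_add] at heval
    simp [q, Polynomial.eval_comp, heval]
  have hqd : q.natDegree ≤ d := by
    refine (Polynomial.natDegree_smul_le _ _).trans (Polynomial.natDegree_comp_le.trans ?_)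
    rw [Polynomial.natDegree_preHilbertPoly, Polynomial.natDegree_X_add_C, mul_one]
  refine (natDegree_le_natDegree_of_eventually (q := q) ?_ ?_).trans hqd
  all_goals filter_upwards [eventually_eq_eval_hilbertPolynomial hI] with m hm
  · exact hm ▸ Nat.cast_nonneg _
  · rw [← hm, hq]
    exact_mod_cast h m

theorem le_degree_of_forall_mul_choose_le (hI : IsHomogeneousIdeal I)
    (hd : (hilbertPolynomial I).natDegree ≤ d) {c : ℕ}
    (h : ∀ m, r * (m + d).choose d ≤ hilbertFunction I (m + c)) : r ≤ degree I d := by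
  have hcoeff :
      ((r : ℚ) • Polynomial.preHilbertPoly ℚ d c).coeff d ≤ (hilbertPolynomial I).coeff d := by
    refine coeff_le_coeff_of_eventually
      ((Polynomial.natDegree_smul_le _ _).trans (Polynomial.natDegree_preHilbertPoly ℚ d c).le)
      hd ?_
    filter_upwards [eventually_eq_eval_hilbertPolynomial hI, eventually_ge_atTop c] with m hm hcm
    have hm' := h (m - c)
    rw [Nat.sub_add_cancel hcm] at hm'
    rw [← hm, Polynomial.eval_smul, Polynomial.preHilbertPoly_eq_choose_sub_add ℚ d hcm,
      smul_eq_mul]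
    exact_mod_cast hm'
  rw [Polynomial.coeff_smul, Polynomial.coeff_preHilbertPoly_self, smul_eq_mul] at hcoeff
  have hfac : (d.factorial : ℚ) ≠ 0 := by positivity
  refine Nat.le_floor ?_
  calc (r : ℚ) = d.factorial * (r * (d.factorial : ℚ)⁻¹) := by field_simp
    _ ≤ _ := by gcongr

end Degree

section MinimalPrimes

variable {k : Type*} [Field k] {n : ℕ} {I : Ideal (MvPolynomial (Fin (n + 1)) k)}

theorem IsHomogeneousIdeal.of_mem_minimalPrimes {P : Ideal (MvPolynomial (Fin (n + 1)) k)}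
    (hI : IsHomogeneousIdeal I) (hP : P ∈ I.minimalPrimes) : IsHomogeneousIdeal P := by
  let _ := MvPolynomial.gradedAlgebra (σ := Fin (n + 1)) (R := k)
  let C := P.homogeneousCore (homogeneousSubmodule (Fin (n + 1)) k)
  have hCP : C.toIdeal ≤ P := Ideal.toIdeal_homogeneousCore_le _ P
  have hIC : I ≤ C.toIdeal :=
    (Ideal.IsHomogeneous.toIdeal_homogeneousCore_eq_self hI).symm.trans_le
      (Ideal.homogeneousCore_mono _ hP.1.2)
  have hC : C.toIdeal.IsPrime := Ideal.IsPrime.homogeneousCore hP.1.1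
  exact (hP.2 ⟨hC, hIC⟩ hCP).antisymm hCP ▸ C.isHomogeneous

theorem exists_isHomogeneous_notMem_forall_mem {ι : Type*} (s : Finset ι)
    {P : ι → Ideal (MvPolynomial (Fin (n + 1)) k)} (hP : ∀ i, IsHomogeneousIdeal (P i))
    {Q : Ideal (MvPolynomial (Fin (n + 1)) k)} [hQ : Q.IsPrime] (hne : ∀ i ∈ s, ¬ P i ≤ Q) :
    ∃ (c : ℕ) (e : MvPolynomial (Fin (n + 1)) k),
      e.IsHomogeneous c ∧ e ∉ Q ∧ ∀ i ∈ s, e ∈ P i := by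
  have hinf : ¬ s.inf P ≤ Q := by simpa only [hQ.inf_le', not_exists, not_and] using hne
  obtain ⟨f, hf, hfQ⟩ := SetLike.not_le_iff_exists.mp hinf
  obtain ⟨c, hc⟩ : ∃ c, homogeneousComponent c f ∉ Q := by
    by_contra! h
    exact hfQ (sum_homogeneousComponent f ▸ Submodule.sum_mem _ fun i _ ↦ h i)
  exact ⟨c, _, homogeneousComponent_isHomogeneous c f, hc, fun i hi ↦
    isHomogeneousIdeal_iff.mp (hP i) f (Finset.inf_le (f := P) hi hf) c⟩

variable {ι : Type*} [Fintype ι] {P : ι → Ideal (MvPolynomial (Fin (n + 1)) k)}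

theorem hilbertFunction_le_sum (hPI : ⨅ i, P i ≤ I) (m : ℕ) :
    hilbertFunction I m ≤ ∑ i, hilbertFunction (P i) m := by
  simp only [hilbertFunction_eq_finrank_range]
  refine finrank_range_le_sum_of_iInf_ker_le _ _ fun f hf ↦ ?_
  exact mem_ker_formsToQuotient.mpr <| hPI <| Submodule.mem_iInf _ |>.mpr fun i ↦
    mem_ker_formsToQuotient.mp ((Submodule.mem_iInf _).mp hf i)

/-- The form `e i` cuts out all components but the `i`-th, so that the subspaces `e i * k[x]` of
`k[x] / I` are independent. -/
theorem sum_hilbertFunction_le (hIP : ∀ i, I ≤ P i) (hP : ∀ i, (P i).IsPrime) {c : ι → ℕ}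
    {e : ι → MvPolynomial (Fin (n + 1)) k} (hc : ∀ i, (e i).IsHomogeneous (c i))
    (he : ∀ i, e i ∉ P i) (he' : ∀ i j, j ≠ i → e i ∈ P j) {m : ℕ} {a : ι → ℕ}
    (ha : ∀ i, c i + a i = m) :
    ∑ i, hilbertFunction (P i) (a i) ≤ hilbertFunction I m := by
  classical
  let T : (∀ i, homogeneousSubmodule (Fin (n + 1)) k (a i)) →ₗ[k] MvPolynomial (Fin (n + 1)) k :=
    ∑ i, LinearMap.mulLeft k (e i) ∘ₗ (homogeneousSubmodule (Fin (n + 1)) k (a i)).subtype ∘ₗ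
      LinearMap.proj i
  have hT (v) : T v = ∑ i, e i * (v i : MvPolynomial (Fin (n + 1)) k) := by
    simp [T]
  have hTm (v) : T v ∈ homogeneousSubmodule (Fin (n + 1)) k m :=
    hT v ▸ Submodule.sum_mem _ fun i _ ↦ ha i ▸ (hc i).mul (v i).2
  have hker : LinearMap.ker (formsToQuotient I m ∘ₗ T.codRestrict _ hTm) ≤
      LinearMap.ker (LinearMap.piMap fun i ↦ formsToQuotient (P i) (a i)) := by
    refine fun v hv ↦ funext fun j ↦ mem_ker_formsToQuotient.mpr ?_
    have hj : T v ∈ P j := hIP j (Ideal.Quotient.eq_zero_iff_mem.mp hv)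
    rw [hT, ← Finset.add_sum_erase _ _ (Finset.mem_univ j)] at hj
    have hsum : ∑ i ∈ Finset.univ.erase j, e i * (v i : MvPolynomial (Fin (n + 1)) k) ∈ P j :=
      Submodule.sum_mem _ fun i hi ↦
        (P j).mul_mem_right _ (he' i j (Finset.ne_of_mem_erase hi).symm)
    exact ((hP j).mem_or_mem (((P j).add_mem_iff_left hsum).mp hj)).resolve_left (he j)
  simp only [hilbertFunction_eq_finrank_range]
  exact (sum_finrank_range_le_of_ker_le_ker_piMap _ _ hker).trans
    (Submodule.finrank_mono (LinearMap.range_comp_le_range _ _))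

end MinimalPrimes

section Radical

variable {k : Type*} [Field k] {n d : ℕ} {I : Ideal (MvPolynomial (Fin (n + 1)) k)}

theorem sum_le_degree {ι : Type*} [Fintype ι] {P : ι → Ideal (MvPolynomial (Fin (n + 1)) k)}
    (hI : IsHomogeneousIdeal I) (hd : (hilbertPolynomial I).natDegree ≤ d) (hIP : ∀ i, I ≤ P i)
    (hP : ∀ i, (P i).IsPrime) (hPhom : ∀ i, IsHomogeneousIdeal (P i))
    (hne : ∀ i j, j ≠ i → ¬ P j ≤ P i) {r : ι → ℕ}
    (hr : ∀ i m, r i * (m + d).choose d ≤ hilbertFunction (P i) (m + r i)) :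
    ∑ i, r i ≤ degree I d := by
  classical
  choose c e hc he he' using fun i ↦
    exists_isHomogeneous_notMem_forall_mem (Finset.univ.erase i) hPhom (Q := P i)
      fun j hj ↦ hne i j (Finset.ne_of_mem_erase hj)
  refine le_degree_of_forall_mul_choose_le hI hd (c := ∑ i, (c i + r i)) fun m ↦ ?_
  choose b hb using fun i ↦ Nat.exists_eq_add_of_le <|
    Finset.single_le_sum (f := fun i ↦ c i + r i) (fun _ _ ↦ Nat.zero_le _) (Finset.mem_univ i)
  calc (∑ i, r i) * (m + d).choose d
    _ ≤ ∑ i, r i * (m + b i + d).choose d := by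
      rw [Finset.sum_mul]
      gcongr
      lia
    _ ≤ ∑ i, hilbertFunction (P i) (m + b i + r i) := Finset.sum_le_sum fun i _ ↦ hr i _
    _ ≤ hilbertFunction I (m + ∑ i, (c i + r i)) :=
      sum_hilbertFunction_le hIP hP hc he
        (fun i j hij ↦ he' i j (Finset.mem_erase.mpr ⟨hij, Finset.mem_univ _⟩))
        fun i ↦ by rw [hb i]; ring

theorem hilbertFunction_le_of_infinite [Infinite k] [PerfectField k] (hI : IsHomogeneousIdeal I)
    (hrad : I.IsRadical) (hdim : ∀ P ∈ I.minimalPrimes, HasDim P d) (m : ℕ) :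
    hilbertFunction I m ≤ ∑ i ∈ Finset.range (degree I d), (m + i + d).choose d := by
  have := (Ideal.finite_minimalPrimes_of_isNoetherianRing _ I).fintype
  have hprime (P : I.minimalPrimes) : P.1.IsPrime := P.2.1.1
  have hhom (P : I.minimalPrimes) : IsHomogeneousIdeal P.1 := hI.of_mem_minimalPrimes P.2
  have hinf : ⨅ P : I.minimalPrimes, P.1 ≤ I := by
    rw [← sInf_eq_iInf', Ideal.sInf_minimalPrimes, hrad.radical]
  choose r hr using fun P : I.minimalPrimes ↦
    exists_bounds_hilbertFunction_of_isPrime (hhom P) (hdim P.1 P.2)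
  have hupper (m : ℕ) :
      hilbertFunction I m ≤ ∑ i ∈ Finset.range (∑ P, r P), (m + i + d).choose d :=
    calc hilbertFunction I m ≤ ∑ P : I.minimalPrimes, hilbertFunction P.1 m :=
          hilbertFunction_le_sum hinf m
      _ ≤ ∑ P, ∑ i ∈ Finset.range (r P), (m + i + d).choose d :=
          Finset.sum_le_sum fun P _ ↦ (hr P m).1
      _ ≤ _ := sum_sum_choose_le _ _ _ _
  have hdeg : (hilbertPolynomial I).natDegree ≤ d :=
    natDegree_hilbertPolynomial_le hI (r := ∑ P, r P) fun m ↦ (hupper m).trans <|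
      (Finset.sum_le_card_nsmul _ _ ((m + ∑ P, r P + d).choose d) fun i hi ↦
        Nat.choose_le_choose d (by have := Finset.mem_range.mp hi; lia)).trans_eq
          (by rw [Finset.card_range, smul_eq_mul])
  refine (hupper m).trans (Finset.sum_le_sum_of_subset (Finset.range_mono ?_))
  exact sum_le_degree hI hdeg (fun P ↦ P.2.1.2) hprime hhom
    (fun P Q hQP hle ↦ hQP (Subtype.ext (hle.antisymm (P.2.2 Q.2.1 hle)))) fun P m ↦ (hr P m).2

end Radical

section ReducedTensorProduct

open TensorProduct

variable {k K : Type*} [Field k] [Field K] [Algebra k K] [Algebra.IsSeparable k K]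

theorem isReduced_field_tensorProduct_of_isSeparable {L : Type*} [Field L] [Algebra k L] :
    IsReduced (L ⊗[k] K) := by
  refine IsReduced.tensorProduct_of_flat_of_forall_fg fun B hB ↦ ?_
  let F := subalgebraEquivIntermediateField (K := k) (L := K) B
  have : Algebra.FiniteType k F := B.fg_iff_finiteType.mp hB
  have : Algebra.FormallyUnramified k F := .of_isSeparable k F
  exact Algebra.FormallyUnramified.isReduced_of_field L (L ⊗[k] F)

variable {A : Type*} [CommRing A] [Algebra k A]

theorem isReduced_tensorProduct_of_isSeparable [IsReduced A] : IsReduced (A ⊗[k] K) := by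
  let b := Module.Free.chooseBasis k K
  let B := Algebra.TensorProduct.basis A b
  refine ⟨fun x hx ↦ B.ext_elem fun i ↦ ?_⟩
  rw [map_zero, Finsupp.zero_apply]
  refine IsNilpotent.eq_zero (nilpotent_iff_mem_prime.mpr fun P hP ↦ ?_)
  let L := FractionRing (A ⧸ P)
  have : IsReduced (L ⊗[k] K) := isReduced_field_tensorProduct_of_isSeparable
  let f : A →ₐ[k] L := IsScalarTower.toAlgHom k A L
  let g : A ⊗[k] K →ₐ[k] L ⊗[k] K := Algebra.TensorProduct.map f (AlgHom.id k K)
  have hg (y) : (Algebra.TensorProduct.basis L b).repr (g y) i = f (B.repr y i) := by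
    induction y with
    | zero => simp
    | tmul a c => simp [g, B]
    | add y z hy hz => simp [hy, hz]
  have hfx : f (B.repr x i) = 0 := by
    rw [← hg, (hx.map g).eq_zero, map_zero, Finsupp.zero_apply]
  rw [← Ideal.Quotient.eq_zero_iff_mem]
  exact FaithfulSMul.algebraMap_injective (A ⧸ P) L (hfx.trans (map_zero _).symm)

end ReducedTensorProduct

section BaseChange

open TensorProduct

variable {k : Type*} [Field k] (K : Type*) [Field K] [Algebra k K]

theorem homogeneousSubmodule_eq_span_image_map (σ : Type*) (m : ℕ) :
    homogeneousSubmodule σ K m =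
      Submodule.span K (map (algebraMap k K) '' homogeneousSubmodule σ k m) := by
  apply le_antisymm
  · intro f hf
    rw [f.as_sum]
    refine Submodule.sum_mem _ fun e he ↦ ?_
    have hmon : (monomial e (1 : k)).IsHomogeneous m :=
      isHomogeneous_monomial 1 <| by
        rw [Finsupp.degree_eq_weight_one]
        exact hf (mem_support_iff.mp he)
    rw [← mul_one (coeff e f), ← smul_eq_mul, ← smul_monomial]
    exact Submodule.smul_mem _ _ (Submodule.subset_span ⟨_, hmon, by simp⟩)
  · rw [Submodule.span_le]
    rintro _ ⟨f, hf, rfl⟩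
    exact hf.map (algebraMap k K)

variable {n : ℕ} (I : Ideal (MvPolynomial (Fin (n + 1)) k))

/-- The extension of the ideal `I` of `k[x₀, …, xₙ]` to `K[x₀, …, xₙ]`. -/
noncomputable abbrev extendScalars : Ideal (MvPolynomial (Fin (n + 1)) K) :=
  I.map (map (algebraMap k K))

theorem extendScalars_eq_map_map : extendScalars K I =
    (I.map Algebra.TensorProduct.includeRight).map
      (algebraTensorAlgEquiv (σ := Fin (n + 1)) k K :
        K ⊗[k] MvPolynomial (Fin (n + 1)) k →+* MvPolynomial (Fin (n + 1)) K) := by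
  have h : map (algebraMap k K) =
      (algebraTensorAlgEquiv (σ := Fin (n + 1)) k K :
        K ⊗[k] MvPolynomial (Fin (n + 1)) k →+* MvPolynomial (Fin (n + 1)) K).comp
        Algebra.TensorProduct.includeRight.toRingHom :=
    RingHom.ext fun f ↦ ((algebraTensorAlgEquiv_tmul k K 1 f).trans (one_smul K _)).symm
  rw [extendScalars, h, ← Ideal.map_map]
  rfl

/-- The canonical isomorphism `K ⊗ (k[x] / I) ≃ K[x] / I K[x]`. -/
noncomputable def quotientExtendScalarsEquiv :
    K ⊗[k] (MvPolynomial (Fin (n + 1)) k ⧸ I) ≃ₐ[K]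
      MvPolynomial (Fin (n + 1)) K ⧸ extendScalars K I :=
  (Algebra.TensorProduct.tensorQuotientEquiv K _ K I).trans <|
    Ideal.quotientEquivAlg _ _ (algebraTensorAlgEquiv k K) (extendScalars_eq_map_map K I)

theorem quotientExtendScalarsEquiv_tmul_mk (c : K) (f : MvPolynomial (Fin (n + 1)) k) :
    quotientExtendScalarsEquiv K I (c ⊗ₜ Ideal.Quotient.mk I f) =
      Ideal.Quotient.mk _ (c • map (algebraMap k K) f) := by
  simp [quotientExtendScalarsEquiv]

theorem hilbertFunction_extendScalars (m : ℕ) :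
    hilbertFunction (extendScalars K I) m = hilbertFunction I m := by
  let V := (homogeneousSubmodule (Fin (n + 1)) k m).map (Ideal.Quotient.mkₐ k I).toLinearMap
  let e := (quotientExtendScalarsEquiv K I).toLinearEquiv
  have hV : (homogeneousSubmodule (Fin (n + 1)) K m).map
      (Ideal.Quotient.mkₐ K (extendScalars K I)).toLinearMap =
        (V.baseChange K).map e.toLinearMap := by
    rw [homogeneousSubmodule_eq_span_image_map (k := k), Submodule.baseChange_eq_span,
      Submodule.map_span, Submodule.map_span]
    congr 1
    simp only [V, Submodule.map_coe, Set.image_image]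
    refine Set.image_congr fun f _ ↦ ?_
    exact .symm <| (quotientExtendScalarsEquiv_tmul_mk K I 1 f).trans <| by rw [one_smul]; rfl
  calc hilbertFunction (extendScalars K I) m
    _ = Module.finrank K (V.baseChange K) := by
      rw [hilbertFunction, hV]
      exact (e.submoduleMap _).finrank_eq.symm
    _ = Module.finrank K (K ⊗[k] V) :=
      (Submodule.toBaseChange.toLinearEquiv K V).finrank_eq.symm
    _ = hilbertFunction I m := Module.finrank_baseChange

theorem degree_extendScalars (d : ℕ) : degree (extendScalars K I) d = degree I d := by
  have h : IsHilbertPolynomial (extendScalars K I) = IsHilbertPolynomial I := by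
    ext p
    simp only [IsHilbertPolynomial, hilbertFunction_extendScalars]
  unfold degree hilbertPolynomial
  rw [h]

variable {K I}

theorem IsHomogeneousIdeal.extendScalars (hI : IsHomogeneousIdeal I) :
    IsHomogeneousIdeal (extendScalars K I) := by
  let _ := MvPolynomial.gradedAlgebra (σ := Fin (n + 1)) (R := k)
  let _ := MvPolynomial.gradedAlgebra (σ := Fin (n + 1)) (R := K)
  obtain ⟨S, rfl⟩ := (Ideal.IsHomogeneous.iff_exists _ _).mp hI
  rw [HomogeneousIdeals.extendScalars, Ideal.map_span]
  refine Ideal.homogeneous_span _ _ ?_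
  rintro _ ⟨_, ⟨f, -, rfl⟩, rfl⟩
  obtain ⟨m, hm⟩ := f.2
  exact ⟨m, IsHomogeneous.map hm (algebraMap k K)⟩

theorem isRadical_extendScalars [Algebra.IsSeparable k K] (hI : I.IsRadical) :
    (extendScalars K I).IsRadical := by
  rw [Ideal.isRadical_iff_quotient_reduced] at hI ⊢
  have : IsReduced ((MvPolynomial (Fin (n + 1)) k ⧸ I) ⊗[k] K) :=
    isReduced_tensorProduct_of_isSeparable
  let e := (quotientExtendScalarsEquiv K I).symm.toRingEquiv.trans
    (Algebra.TensorProduct.comm k K (MvPolynomial (Fin (n + 1)) k ⧸ I)).toRingEquiv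
  exact isReduced_of_injective e e.injective

attribute [local instance] MvPolynomial.algebraMvPolynomial in
theorem hasDim_of_mem_minimalPrimes_extendScalars [Algebra.IsIntegral k K] {d : ℕ}
    (hI : ∀ P ∈ I.minimalPrimes, HasDim P d) {Q : Ideal (MvPolynomial (Fin (n + 1)) K)}
    (hQ : Q ∈ (extendScalars K I).minimalPrimes) : HasDim Q d := by
  have : Module.Flat (MvPolynomial (Fin (n + 1)) k) (MvPolynomial (Fin (n + 1)) K) :=
    Module.Flat.of_linearEquiv (Algebra.IsPushout.equiv k (MvPolynomial (Fin (n + 1)) k) K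
      (MvPolynomial (Fin (n + 1)) K)).symm.toLinearEquiv
  have : Algebra.IsIntegral (MvPolynomial (Fin (n + 1)) k) (MvPolynomial (Fin (n + 1)) K) :=
    ⟨fun f ↦ MvPolynomial.isIntegral_iff_isIntegral_coeff.mpr fun _ ↦
      Algebra.IsIntegral.isIntegral _⟩
  have hQprime : Q.IsPrime := hQ.1.1
  let P := Q.comap (algebraMap (MvPolynomial (Fin (n + 1)) k) (MvPolynomial (Fin (n + 1)) K))
  have hPprime : P.IsPrime := Ideal.comap_isPrime _ Q
  have hP : P ∈ I.minimalPrimes := by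
    refine ⟨⟨hPprime, Ideal.map_le_iff_le_comap.mp hQ.1.2⟩, fun P₀ ⟨hP₀, hIP₀⟩ hle ↦ ?_⟩
    have : Q.LiesOver P := ⟨rfl⟩
    obtain ⟨Q₀, hQ₀Q, hQ₀, hlies⟩ := Ideal.exists_ideal_le_liesOver_of_le Q hle
    have hIQ₀ : extendScalars K I ≤ Q₀ :=
      Ideal.map_le_iff_le_comap.mpr (hIP₀.trans hlies.over.le)
    exact (Ideal.comap_mono (hQ.2 ⟨hQ₀, hIQ₀⟩ hQ₀Q)).trans hlies.over.ge
  exact (ringKrullDim_eq_of_isIntegral (MvPolynomial (Fin (n + 1)) k ⧸ P)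
    (MvPolynomial (Fin (n + 1)) K ⧸ Q)).trans (hI P hP)

end BaseChange

section Unmixed

theorem exists_mem_minimalPrimes_le_ringKrullDim {R : Type*} [CommRing R] {I : Ideal R} {d : ℕ}
    (h : (d : WithBot ℕ∞) ≤ ringKrullDim (R ⧸ I)) :
    ∃ P ∈ I.minimalPrimes, (d : WithBot ℕ∞) ≤ ringKrullDim (R ⧸ P) := by
  rw [ringKrullDim_quotient, Order.le_krullDim_iff] at h
  obtain ⟨s, rfl⟩ := h
  have hprime := s.head.1.2
  obtain ⟨P, hP, hle⟩ := Ideal.exists_minimalPrimes_le (J := s.head.1.asIdeal) s.head.2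
  refine ⟨P, hP, ?_⟩
  rw [ringKrullDim_quotient, Order.le_krullDim_iff]
  exact ⟨⟨s.length, fun i ↦ ⟨(s i).1, hle.trans (LTSeries.head_le s i)⟩, fun i ↦ s.step i⟩, rfl⟩

variable {k : Type*} [Field k] {n d : ℕ} {I : Ideal (MvPolynomial (Fin (n + 1)) k)}

theorem IsUnmixed.hasDim_of_mem_minimalPrimes (hI : IsUnmixed I) (hd : HasDim I d)
    {P : Ideal (MvPolynomial (Fin (n + 1)) k)} (hP : P ∈ I.minimalPrimes) : HasDim P d := by
  have hass : I.minimalPrimes ⊆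
      associatedPrimes (MvPolynomial (Fin (n + 1)) k) (MvPolynomial (Fin (n + 1)) k ⧸ I) := by
    simpa only [Ideal.annihilator_quotient] using
      Module.associatedPrimes.minimalPrimes_annihilator_subset_associatedPrimes
        (MvPolynomial (Fin (n + 1)) k) (MvPolynomial (Fin (n + 1)) k ⧸ I)
  have hcast : ((d + 1 : ℕ) : WithBot ℕ∞) = (d : WithBot ℕ∞) + 1 := Nat.cast_succ d
  obtain ⟨Q, hQ, hQd⟩ : ∃ Q ∈ I.minimalPrimes,
      ((d + 1 : ℕ) : WithBot ℕ∞) ≤ ringKrullDim (MvPolynomial (Fin (n + 1)) k ⧸ Q) :=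
    exists_mem_minimalPrimes_le_ringKrullDim (hcast.trans_le hd.ge)
  have hQ' : HasDim Q d :=
    (ringKrullDim_le_of_surjective (Ideal.Quotient.factor hQ.1.2)
      (Ideal.Quotient.factor_surjective hQ.1.2)).trans_eq hd |>.antisymm
        (hcast.symm.trans_le hQd)
  exact (hI P (hass hP) Q (hass hQ)).trans hQ'

end Unmixed

theorem hilbertFunction_le_sum_choose {k : Type*} [Field k] [PerfectField k] {n d : ℕ}
    {I : Ideal (MvPolynomial (Fin (n + 1)) k)} (hI : IsHomogeneousIdeal I) (hrad : I.IsRadical)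
    (hdim : ∀ P ∈ I.minimalPrimes, HasDim P d) (m : ℕ) :
    hilbertFunction I m ≤ ∑ i ∈ Finset.range (degree I d), (m + i + d).choose d := by
  have : Infinite (AlgebraicClosure k) := IsAlgClosed.instInfinite
  have h := hilbertFunction_le_of_infinite (hI.extendScalars (K := AlgebraicClosure k))
    (isRadical_extendScalars hrad)
    (fun Q hQ ↦ hasDim_of_mem_minimalPrimes_extendScalars hdim hQ) m
  rwa [hilbertFunction_extendScalars, degree_extendScalars] at h

end HomogeneousIdeals

theorem theorem2p2 {k : Type*} [Field k] [PerfectField k] {n d : ℕ}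
    (I : Ideal (MvPolynomial (Fin (n + 1)) k))
    (hhom : HomogeneousIdeals.IsHomogeneousIdeal I)
    (hunmixed : HomogeneousIdeals.IsUnmixed I)
    (hrad : I.IsRadical)
    (hdim : HomogeneousIdeals.HasDim I d)
    (m : ℕ) (hm : 1 ≤ m) :
    (HomogeneousIdeals.hilbertFunction I m : ℤ) ≤
      ((m + HomogeneousIdeals.degree I d + d).choose (d + 1) : ℤ) -
        ((m + d).choose (d + 1) : ℤ) := by
  have h := HomogeneousIdeals.hilbertFunction_le_sum_choose hhom hrad
    (fun P hP ↦ hunmixed.hasDim_of_mem_minimalPrimes hdim hP) m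
  rw [← HomogeneousIdeals.sum_choose_add_choose d m]
  push_cast
  rw [add_sub_cancel_right]
  exact_mod_cast h
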